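/- Let $R$ be a commutative ring in which $2$ is invertible, let $(\omega_a)_{a\ge 0}$ be a sequence of elements of $R$, let $r\ge 1$ be an integer and let $u_1,\dots,u_r\in R$. For $n\ge1$, the degenerate affine BMW algebra $W^{\mathrm{aff}}_n$ is the unital associative $R$-algebra with generators $s_i,e_i$ ($1\le i<n$), $x_j$ ($1\le j\le n$) and relations (for all indices for which they make sense): $s_i^2=1$; $s_is_j=s_js_i$ if $|i-j|>1$; $s_is_{i+1}s_i=s_{i+1}s_is_{i+1}$; $s_ix_j=x_js_i$ if $j\ne i,i+1$; $e_i^2=\omega_0e_i$; $s_ie_j=e_js_i$ and $e_ie_j=e_je_i$ if $|i-j|>1$; $e_ix_j=x_je_i$ if $j\neq i,i+1$; $x_ix_j=x_jx_i$; $s_ix_i-x_{i+1}s_i=e_i-1$ and $x_is_i-s_ix_{i+1}=e_i-1$; $e_1x_1^ae_1=\omega_ae_1$ for $a>0$; $e_is_i=e_i=s_ie_i$; $s_ie_{i+1}e_i=s_{i+1}e_i$, $e_ie_{i+1}s_i=e_is_{i+1}$, $e_{i+1}e_is_{i+1}=e_{i+1}s_i$, $s_{i+1}e_ie_{i+1}=s_ie_{i+1}$;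 $e_{i+1}e_ie_{i+1}=e_{i+1}$, $e_ie_{i+1}e_i=e_i$; $e_i(x_i+x_{i+1})=0=(x_i+x_{i+1})e_i$. Let $W=W_{2,r}(u_1,\dots,u_r)$ be the two-strand degenerate cyclotomic BMW algebra, that is, the quotient of $W^{\mathrm{aff}}_2$ by the two-sided ideal generated by $(x_1-u_1)\cdots(x_1-u_r)$. For $0\le j\le r$ put $a_j=(-1)^{r-j}\varepsilon_{r-j}(u_1,\dots,u_r)$, where $\varepsilon_k$ is the $k$-th elementary symmetric polynomial. For a condition $P$ let $\delta_{(P)}$ be $1$ if $P$ holds and $0$ otherwise. The parameters $\omega_a$ ($a\ge0$), $u_1,\dots,u_r$ are called *admissible* if $$\sum_{\mu=0}^{r-j-1}\omega_\mu a_{\mu+j+1}=-2\,\delta_{(r-j\text{ is odd})}\,a_j+\delta_{(j\text{ is even})}\,a_{j+1}\quad(0\le j\le r-1)$$ and $$\sum_{\mu=0}^{r}a_\mu\omega_{\mu+a}=0\quad(a\ge0).$$ Let $q_a$ ($a \ge 0$) be the Schur $q$-functions, that is, the polynomials with integer coefficients in the indeterminates $\boldsymbol u_1,\dots,\boldsymbol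 u_r$ defined by $\prod_{i=1}^r\frac{1+\boldsymbol u_it}{1-\boldsymbol u_it}=\sum_{a\ge0}q_a(\boldsymbol u)t^a$. The parameters are called *$u$-admissible* if $$\omega_a=q_{a+1}(u_1,\dots,u_r)+\tfrac12(-1)^{r-1}q_a(u_1,\dots,u_r)+\tfrac12\delta_{(a=0)}\quad(a\ge0).$$ Then the following are equivalent: 1. The family $e_1,\ x_1e_1,\ \dots,\ x_1^{r-1}e_1$ in $W$ is linearly independent over $R$. 2. The family of the $3r^2$ elements $x_1^ae_1x_1^b,\ x_1^ax_2^bs_1,\ x_1^ax_2^b$ ($0\le a,b\le r-1$) of $W$ is linearly independent over $R$. 3. The parameters are admissible. 4. The parameters are $u$-admissible. -/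

import Mathlib

namespace DegBMW

universe u

/-- The generators of the degenerate affine BMW algebra on `n = m + 1` strands:
`s_i`, `e_i` for `1 ≤ i < n` and `x_j` for `1 ≤ j ≤ n`.  Indices are shifted by one, so the index
`i : Fin m` stands for `i + 1`; the strands next to it are `i.castSucc` and `i.succ`. -/
inductive Gen (m : ℕ) : Type
  | s (i : Fin m) : Gen m
  | e (i : Fin m) : Gen m
  | x (j : Fin (m + 1)) : Gen m

section Free

variable (R : Type u) [CommRing R] {m : ℕ}

/-- The free generator `s_i`. -/
abbrev fs (i : Fin m) : FreeAlgebra R (Gen m) := FreeAlgebra.ι R (Gen.s i)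

/-- The free generator `e_i`. -/
abbrev fe (i : Fin m) : FreeAlgebra R (Gen m) := FreeAlgebra.ι R (Gen.e i)

/-- The free generator `x_j`. -/
abbrev fx (j : Fin (m + 1)) : FreeAlgebra R (Gen m) := FreeAlgebra.ι R (Gen.x j)

end Free

/-- The condition `|i - j| > 1`. -/
def Far {m : ℕ} (i j : Fin m) : Prop := (i : ℕ) + 1 < j ∨ (j : ℕ) + 1 < i

/-- The defining relations of the degenerate affine BMW algebra on `m + 1` strands with
parameters `ω_a`, `a ≥ 0`. -/
inductive AffRel {R : Type u} [CommRing R] (ω : ℕ → R) (m : ℕ) :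
    FreeAlgebra R (Gen m) → FreeAlgebra R (Gen m) → Prop
  -- involutions
  | s_sq (i : Fin m) : AffRel ω m (fs R i * fs R i) 1
  -- affine braid relations
  | s_comm (i j : Fin m) (h : Far i j) : AffRel ω m (fs R i * fs R j) (fs R j * fs R i)
  | braid (i j : Fin m) (h : (j : ℕ) = i + 1) :
      AffRel ω m (fs R i * fs R j * fs R i) (fs R j * fs R i * fs R j)
  | s_x_comm (i : Fin m) (j : Fin (m + 1)) (h₁ : j ≠ i.castSucc) (h₂ : j ≠ i.succ) :
      AffRel ω m (fs R i * fx R j) (fx R j * fs R i)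
  -- idempotent relations
  | e_sq (i : Fin m) : AffRel ω m (fe R i * fe R i) (ω 0 • fe R i)
  -- commutation relations
  | s_e_comm (i j : Fin m) (h : Far i j) : AffRel ω m (fs R i * fe R j) (fe R j * fs R i)
  | e_comm (i j : Fin m) (h : Far i j) : AffRel ω m (fe R i * fe R j) (fe R j * fe R i)
  | e_x_comm (i : Fin m) (j : Fin (m + 1)) (h₁ : j ≠ i.castSucc) (h₂ : j ≠ i.succ) :
      AffRel ω m (fe R i * fx R j) (fx R j * fe R i)
  | x_comm (i j : Fin (m + 1)) : AffRel ω m (fx R i * fx R j) (fx R j * fx R i)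
  -- skein relations
  | skein_left (i : Fin m) :
      AffRel ω m (fs R i * fx R i.castSucc - fx R i.succ * fs R i) (fe R i - 1)
  | skein_right (i : Fin m) :
      AffRel ω m (fx R i.castSucc * fs R i - fs R i * fx R i.succ) (fe R i - 1)
  -- unwrapping relations, for the first contraction and the first strand
  | unwrap (h : 0 < m) (a : ℕ) (ha : 0 < a) :
      AffRel ω m (fe R ⟨0, h⟩ * fx R 0 ^ a * fe R ⟨0, h⟩) (ω a • fe R ⟨0, h⟩)
  -- tangle relations
  | e_s (i : Fin m) : AffRel ω m (fe R i * fs R i) (fe R i)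
  | s_e (i : Fin m) : AffRel ω m (fs R i * fe R i) (fe R i)
  | s_e_e (i j : Fin m) (h : (j : ℕ) = i + 1) :
      AffRel ω m (fs R i * fe R j * fe R i) (fs R j * fe R i)
  | e_e_s (i j : Fin m) (h : (j : ℕ) = i + 1) :
      AffRel ω m (fe R i * fe R j * fs R i) (fe R i * fs R j)
  | e_e_s_succ (i j : Fin m) (h : (j : ℕ) = i + 1) :
      AffRel ω m (fe R j * fe R i * fs R j) (fe R j * fs R i)
  | s_e_e_succ (i j : Fin m) (h : (j : ℕ) = i + 1) :
      AffRel ω m (fs R j * fe R i * fe R j) (fs R i * fe R j)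
  -- untwisting relations
  | untwist_succ (i j : Fin m) (h : (j : ℕ) = i + 1) :
      AffRel ω m (fe R j * fe R i * fe R j) (fe R j)
  | untwist (i j : Fin m) (h : (j : ℕ) = i + 1) :
      AffRel ω m (fe R i * fe R j * fe R i) (fe R i)
  -- anti-symmetry relations
  | antisymm_left (i : Fin m) : AffRel ω m (fe R i * (fx R i.castSucc + fx R i.succ)) 0
  | antisymm_right (i : Fin m) : AffRel ω m ((fx R i.castSucc + fx R i.succ) * fe R i) 0

/-- The degenerate affine BMW algebra on `m + 1` strands. -/
def Aff {R : Type u} [CommRing R] (ω : ℕ → R) (m : ℕ) : Type u := RingQuot (AffRel ω m)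

noncomputable instance {R : Type u} [CommRing R] (ω : ℕ → R) (m : ℕ) : Ring (Aff ω m) :=
  inferInstanceAs (Ring (RingQuot (AffRel ω m)))

noncomputable instance {R : Type u} [CommRing R] (ω : ℕ → R) (m : ℕ) : Algebra R (Aff ω m) :=
  inferInstanceAs (Algebra R (RingQuot (AffRel ω m)))

/-- The image of a free generator in the degenerate affine BMW algebra. -/
noncomputable def Aff.gen {R : Type u} [CommRing R] (ω : ℕ → R) {m : ℕ} (g : Gen m) : Aff ω m :=
  RingQuot.mkAlgHom R (AffRel ω m) (FreeAlgebra.ι R g)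

/-- The cyclotomic relation `(x_1 - u_1) ⋯ (x_1 - u_r) = 0`. -/
inductive CycRel {R : Type u} [CommRing R] (ω : ℕ → R) {r : ℕ} (v : Fin r → R) (m : ℕ) :
    Aff ω m → Aff ω m → Prop
  | cyc : CycRel ω v m
      (Polynomial.aeval (Aff.gen ω (Gen.x (0 : Fin (m + 1))))
        (∏ i : Fin r, (Polynomial.X - Polynomial.C (v i)))) 0

/-- The degenerate cyclotomic BMW algebra on `m + 1` strands with parameters
`ω_a`, `a ≥ 0`, and `u_1, …, u_r` (here `v`): the quotient of the affine algebra by the two-sided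
ideal generated by `(x_1 - u_1) ⋯ (x_1 - u_r)`. -/
def Cyc {R : Type u} [CommRing R] (ω : ℕ → R) {r : ℕ} (v : Fin r → R) (m : ℕ) : Type u :=
  RingQuot (CycRel ω v m)

noncomputable instance {R : Type u} [CommRing R] (ω : ℕ → R) {r : ℕ} (v : Fin r → R) (m : ℕ) :
    Ring (Cyc ω v m) :=
  inferInstanceAs (Ring (RingQuot (CycRel ω v m)))

noncomputable instance {R : Type u} [CommRing R] (ω : ℕ → R) {r : ℕ} (v : Fin r → R) (m : ℕ) :
    Algebra R (Cyc ω v m) :=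
  inferInstanceAs (Algebra R (RingQuot (CycRel ω v m)))

section TwoStrand

variable {R : Type u} [CommRing R] (ω : ℕ → R) {r : ℕ} (v : Fin r → R)

/-- The two-strand degenerate cyclotomic BMW algebra `W_{2,r}(u_1, …, u_r)`. -/
abbrev W₂ : Type u := Cyc ω v 1

/-- The image of a generator in the two-strand algebra. -/
noncomputable def W₂.gen (g : Gen 1) : W₂ ω v :=
  RingQuot.mkAlgHom R (CycRel ω v 1) (Aff.gen ω g)

/-- The element `e_1`. -/
noncomputable def e₁ : W₂ ω v := W₂.gen ω v (Gen.e 0)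

/-- The element `s_1`. -/
noncomputable def s₁ : W₂ ω v := W₂.gen ω v (Gen.s 0)

/-- The element `x_1`. -/
noncomputable def x₁ : W₂ ω v := W₂.gen ω v (Gen.x 0)

/-- The element `x_2`. -/
noncomputable def x₂ : W₂ ω v := W₂.gen ω v (Gen.x 1)

/-- The family `e_1, x_1 e_1, …, x_1^{r-1} e_1`. -/
noncomputable def idealFamily (a : Fin r) : W₂ ω v := x₁ ω v ^ (a : ℕ) * e₁ ω v

/-- The family of the `3 r ^ 2` elements `x_1^a e_1 x_1^b`, `x_1^a x_2^b s_1`, `x_1^a x_2^b` with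
`0 ≤ a, b ≤ r - 1`. -/
noncomputable def algebraFamily :
    (Fin r × Fin r) ⊕ (Fin r × Fin r) ⊕ (Fin r × Fin r) → W₂ ω v
  | Sum.inl (a, b) => x₁ ω v ^ (a : ℕ) * e₁ ω v * x₁ ω v ^ (b : ℕ)
  | Sum.inr (Sum.inl (a, b)) => x₁ ω v ^ (a : ℕ) * x₂ ω v ^ (b : ℕ) * s₁ ω v
  | Sum.inr (Sum.inr (a, b)) => x₁ ω v ^ (a : ℕ) * x₂ ω v ^ (b : ℕ)

/-- The signed elementary symmetric functions `a_j = (-1)^{r-j} ε_{r-j}(u_1, …, u_r)`, for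
`0 ≤ j ≤ r`. -/
def signedEsymm (j : ℕ) : R :=
  (-1) ^ (r - j) * (Finset.univ.val.map v).esymm (r - j)

/-- Admissibility of the parameters. -/
def Admissible : Prop :=
  (∀ j : ℕ, j < r →
    ∑ μ ∈ Finset.range (r - j), ω μ * signedEsymm v (μ + j + 1) =
      -2 * (if Odd (r - j) then 1 else 0) * signedEsymm v j
        + (if Even j then 1 else 0) * signedEsymm v (j + 1)) ∧
  ∀ a : ℕ, ∑ μ ∈ Finset.range (r + 1), signedEsymm v μ * ω (μ + a) = 0

end TwoStrand

/-- The Schur q-function `q_a`, a polynomial in `r` variables over `ℤ`: the coefficient of `t^a` in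
`∏_i (1 + u_i t) / (1 - u_i t)`. -/
noncomputable def schurQ (r a : ℕ) : MvPolynomial (Fin r) ℤ :=
  PowerSeries.coeff a
    (∏ i : Fin r,
      ((1 + PowerSeries.C (MvPolynomial.X i : MvPolynomial (Fin r) ℤ) * PowerSeries.X) *
        PowerSeries.invOfUnit
          (1 - PowerSeries.C (MvPolynomial.X i : MvPolynomial (Fin r) ℤ) * PowerSeries.X) 1))

/-- `u`-admissibility of the parameters: for all `a ≥ 0`,
`ω_a = q_{a+1}(u) + (1/2) (-1)^{r-1} q_a(u) + (1/2) δ_{a,0}`. -/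
def UAdmissible {R : Type u} [CommRing R] [Invertible (2 : R)] (ω : ℕ → R) {r : ℕ}
    (v : Fin r → R) : Prop :=
  ∀ a : ℕ, ω a = MvPolynomial.aeval v (schurQ r (a + 1))
    + ⅟(2 : R) * (-1) ^ (r - 1) * MvPolynomial.aeval v (schurQ r a)
    + ⅟(2 : R) * (if a = 0 then 1 else 0)

end DegBMW

namespace DegBMW

/-! Put p = ∏ (X - u_i), whose coefficients are the a_j by Vieta. The implication 2 → 1 passes to a
subfamily, and 3 ↔ 4 is an identity of power series.

For 1 → 3, p(x₁)e₁ = 0. Multiplying by s₁ and moving s₁ to the right with the skein relation gives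
another relation among the x₁^j e₁, and its coefficients are the first admissibility conditions.
Multiplying by e₁x₁^a instead gives a multiple of e₁, namely the second conditions.

For 3 → 2, admissible ω are determined by u, because ∏ (1 - u_i t) is a unit among power series.
Hence the admissible data over R specialize those over ℤ[X_1, …, X_r]. The 3r² elements always span
(`span_algebraFamily`), so independence over the polynomial ring makes them a basis, and a basis
survives base change (`LinearIndependent.algebraFamily_map`). It remains to work over the fraction
field, where the u_i are generic. There enough explicit representations exist (`rels_one`,
`rels_two`, `rels_ideal`): those with e = 0 kill the coefficients of x₁^a x₂^b and x₁^a x₂^b s₁, and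
an r-dimensional one with e of rank one kills those of x₁^a e₁ x₁^b. -/

/-- The monic polynomial `∏ (X - v_i)`. -/
noncomputable def cycPoly {R : Type*} [CommRing R] {r : ℕ} (v : Fin r → R) : Polynomial R :=
  ∏ i : Fin r, (Polynomial.X - Polynomial.C (v i))

/-- The relations of the two-strand algebra for elements `s`, `e`, `x`, `y` of an algebra. -/
structure Rels {R : Type*} [CommRing R] (ω : ℕ → R) {r : ℕ} (v : Fin r → R)
    {B : Type*} [Ring B] [Algebra R B] (s e x y : B) : Prop where
  s_sq : s * s = 1
  x_comm : x * y = y * x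
  skein_left : s * x - y * s = e - 1
  skein_right : x * s - s * y = e - 1
  unwrap (a : ℕ) : e * x ^ a * e = ω a • e
  e_s : e * s = e
  s_e : s * e = e
  antisymm_left : e * (x + y) = 0
  antisymm_right : (x + y) * e = 0
  cyc : Polynomial.aeval x (cycPoly v) = 0

/-! ### Presentation and universal property of the two-strand algebra. -/

section Lift

variable {R : Type*} [CommRing R] (ω : ℕ → R) {r : ℕ} (v : Fin r → R)

/-- The projection from the free algebra. -/
noncomputable def W₂.proj : FreeAlgebra R (Gen 1) →ₐ[R] W₂ ω v :=
  (RingQuot.mkAlgHom R (CycRel ω v 1)).comp (RingQuot.mkAlgHom R (AffRel ω 1))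

theorem W₂.proj_surjective : Function.Surjective (W₂.proj ω v) :=
  (RingQuot.mkAlgHom_surjective R (CycRel ω v 1)).comp
    (RingQuot.mkAlgHom_surjective R (AffRel ω 1))

theorem W₂.proj_ι (g : Gen 1) : W₂.proj ω v (FreeAlgebra.ι R g) = W₂.gen ω v g := rfl

theorem W₂.proj_rel {a b : FreeAlgebra R (Gen 1)} (h : AffRel ω 1 a b) :
    W₂.proj ω v a = W₂.proj ω v b :=
  congrArg (RingQuot.mkAlgHom R (CycRel ω v 1)) (RingQuot.mkAlgHom_rel R h)

theorem W₂.rels : Rels ω v (s₁ ω v) (e₁ ω v) (x₁ ω v) (x₂ ω v) where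
  s_sq := by simpa [W₂.proj_ι, s₁, e₁, x₁, x₂] using W₂.proj_rel ω v (AffRel.s_sq 0)
  x_comm := by simpa [W₂.proj_ι, s₁, e₁, x₁, x₂] using W₂.proj_rel ω v (AffRel.x_comm 0 1)
  skein_left := by simpa [W₂.proj_ι, s₁, e₁, x₁, x₂] using W₂.proj_rel ω v (AffRel.skein_left 0)
  skein_right := by simpa [W₂.proj_ι, s₁, e₁, x₁, x₂] using W₂.proj_rel ω v (AffRel.skein_right 0)
  unwrap a := by
    rcases Nat.eq_zero_or_pos a with rfl | ha
    · simpa [W₂.proj_ι, s₁, e₁, x₁, x₂] using W₂.proj_rel ω v (AffRel.e_sq 0)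
    · simpa [W₂.proj_ι, s₁, e₁, x₁, x₂] using W₂.proj_rel ω v (AffRel.unwrap Nat.one_pos a ha)
  e_s := by simpa [W₂.proj_ι, s₁, e₁, x₁, x₂] using W₂.proj_rel ω v (AffRel.e_s 0)
  s_e := by simpa [W₂.proj_ι, s₁, e₁, x₁, x₂] using W₂.proj_rel ω v (AffRel.s_e 0)
  antisymm_left := by simpa [W₂.proj_ι, s₁, e₁, x₁, x₂] using W₂.proj_rel ω v (AffRel.antisymm_left 0)
  antisymm_right := by simpa [W₂.proj_ι, s₁, e₁, x₁, x₂] using W₂.proj_rel ω v (AffRel.antisymm_right 0)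
  cyc := by
    have h := RingQuot.mkAlgHom_rel R (CycRel.cyc (ω := ω) (v := v) (m := 1))
    rw [map_zero] at h
    exact (Polynomial.aeval_algHom_apply (RingQuot.mkAlgHom R (CycRel ω v 1)) _ _).trans h

variable {ω v} {B : Type*} [Ring B] [Algebra R B] {s e x y : B}

/-- The values of the generators. -/
def genVal (s e x y : B) : Gen 1 → B
  | Gen.s _ => s
  | Gen.e _ => e
  | Gen.x 0 => x
  | Gen.x 1 => y

theorem Rels.aff (h : Rels ω v s e x y) {a b : FreeAlgebra R (Gen 1)} (hab : AffRel ω 1 a b) :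
    FreeAlgebra.lift R (genVal s e x y) a = FreeAlgebra.lift R (genVal s e x y) b := by
  -- With two strands there is one index for s and e, so every relation between distinct or far
  -- indices is vacuous.
  have far (i j : Fin 1) : ¬ Far i j := by unfold Far; omega
  have succ (i j : Fin 1) : ¬ ((j : ℕ) = i + 1) := by omega
  have two (i : Fin 1) (j : Fin 2) (h₁ : j ≠ i.castSucc) (h₂ : j ≠ i.succ) : False := by
    fin_cases i; fin_cases j <;> simp at h₁ h₂
  cases hab with
  | s_sq i => simpa [genVal] using h.s_sq
  | s_comm i j hf => exact (far i j hf).elim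
  | braid i j hf => exact (succ i j hf).elim
  | s_x_comm i j h₁ h₂ => exact (two i j h₁ h₂).elim
  | e_sq i => simpa [genVal] using h.unwrap 0
  | s_e_comm i j hf => exact (far i j hf).elim
  | e_comm i j hf => exact (far i j hf).elim
  | e_x_comm i j h₁ h₂ => exact (two i j h₁ h₂).elim
  | x_comm i j =>
    fin_cases i <;> fin_cases j <;> simp [genVal, h.x_comm]
  | skein_left i => fin_cases i; simpa [genVal] using h.skein_left
  | skein_right i => fin_cases i; simpa [genVal] using h.skein_right
  | unwrap _ a ha => simpa [genVal] using h.unwrap a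
  | e_s i => simpa [genVal] using h.e_s
  | s_e i => simpa [genVal] using h.s_e
  | s_e_e i j hf => exact (succ i j hf).elim
  | e_e_s i j hf => exact (succ i j hf).elim
  | e_e_s_succ i j hf => exact (succ i j hf).elim
  | s_e_e_succ i j hf => exact (succ i j hf).elim
  | untwist_succ i j hf => exact (succ i j hf).elim
  | untwist i j hf => exact (succ i j hf).elim
  | antisymm_left i => fin_cases i; simpa [genVal] using h.antisymm_left
  | antisymm_right i => fin_cases i; simpa [genVal] using h.antisymm_right

/-- Independence is always tested through this map: a linear relation in `W₂` is carried to explicit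
matrices or to a base change. -/
theorem Rels.exists_lift (h : Rels ω v s e x y) :
    ∃ f : W₂ ω v →ₐ[R] B, f (s₁ ω v) = s ∧ f (e₁ ω v) = e ∧ f (x₁ ω v) = x ∧ f (x₂ ω v) = y := by
  let f₁ : Aff ω 1 →ₐ[R] B :=
    RingQuot.liftAlgHom R ⟨FreeAlgebra.lift R (genVal s e x y), fun _ _ hab => h.aff hab⟩
  have hf₁ (g : Gen 1) : f₁ (Aff.gen ω g) = genVal s e x y g :=
    (RingQuot.liftAlgHom_mkAlgHom_apply R _ (fun _ _ hab => h.aff hab) _).trans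
      (FreeAlgebra.lift_ι_apply _ _)
  have hc : ∀ ⦃a b : Aff ω 1⦄, CycRel ω v 1 a b → f₁ a = f₁ b := by
    rintro a b ⟨⟩
    rw [map_zero, ← Polynomial.aeval_algHom_apply, hf₁]
    exact h.cyc
  let f : W₂ ω v →ₐ[R] B := RingQuot.liftAlgHom R ⟨f₁, hc⟩
  have hf (g : Gen 1) : f (W₂.gen ω v g) = genVal s e x y g :=
    (RingQuot.liftAlgHom_mkAlgHom_apply R _ hc _).trans (hf₁ g)
  exact ⟨f, hf _, hf _, hf _, hf _⟩

/-- A left-stable submodule containing `1` is everything. -/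
theorem W₂.eq_top (S : Submodule R (W₂ ω v)) (h1 : (1 : W₂ ω v) ∈ S)
    (hs : ∀ z ∈ S, s₁ ω v * z ∈ S) (he : ∀ z ∈ S, e₁ ω v * z ∈ S)
    (hx : ∀ z ∈ S, x₁ ω v * z ∈ S) (hy : ∀ z ∈ S, x₂ ω v * z ∈ S) : S = ⊤ := by
  rw [eq_top_iff]
  rintro w -
  obtain ⟨a, rfl⟩ := W₂.proj_surjective ω v w
  suffices H : ∀ z ∈ S, W₂.proj ω v a * z ∈ S by simpa using H 1 h1
  induction a using FreeAlgebra.induction with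
  | grade0 c => intro z hz; simpa [Algebra.algebraMap_eq_smul_one] using S.smul_mem c hz
  | grade1 g =>
    rw [W₂.proj_ι]
    match g with
    | Gen.s 0 => exact hs
    | Gen.e 0 => exact he
    | Gen.x 0 => exact hx
    | Gen.x 1 => exact hy
  | mul a b iha ihb => intro z hz; rw [map_mul, mul_assoc]; exact iha _ (ihb _ hz)
  | add a b iha ihb => intro z hz; rw [map_add, add_mul]; exact S.add_mem (iha _ hz) (ihb _ hz)

end Lift

/-! ### The cyclotomic polynomial and its coefficients. -/

section Poly

variable {R : Type*} [CommRing R] {r : ℕ} (v : Fin r → R)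

theorem cycPoly_monic : (cycPoly v).Monic :=
  Polynomial.monic_prod_of_monic _ _ fun i _ => Polynomial.monic_X_sub_C (v i)

theorem cycPoly_natDegree [Nontrivial R] : (cycPoly v).natDegree = r := by
  simp [cycPoly]

theorem cycPoly_natDegree_le : (cycPoly v).natDegree ≤ r := by
  nontriviality R
  exact (cycPoly_natDegree v).le

theorem cycPoly_coeff_top : (cycPoly v).coeff r = 1 := by
  nontriviality R
  simpa [cycPoly_natDegree] using (cycPoly_monic v).coeff_natDegree

theorem aeval_cycPoly {B : Type*} [Ring B] [Algebra R B] (x : B) :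
    Polynomial.aeval x (cycPoly v) = ∑ j ∈ Finset.range (r + 1), (cycPoly v).coeff j • x ^ j :=
  Polynomial.aeval_eq_sum_range' (Nat.lt_succ_of_le (cycPoly_natDegree_le v)) x

theorem signedEsymm_eq_coeff {j : ℕ} (hj : j ≤ r) : signedEsymm v j = (cycPoly v).coeff j := by
  have h := Multiset.prod_X_sub_C_coeff (Finset.univ.val.map v) (k := j) (by simpa using hj)
  simp only [Multiset.map_map, Multiset.card_map, Finset.card_val, Finset.card_univ,
    Fintype.card_fin] at h
  exact h.symm

end Poly

/-! ### Spanning by the 3r² elements, for arbitrary parameters. -/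

section Span

variable {R : Type*} [CommRing R] {ω : ℕ → R} {r : ℕ} {v : Fin r → R}
  {B : Type*} [Ring B] [Algebra R B] {s e x y : B}

theorem mul_mem_of_span_left {A : Set B} {S : Submodule R B} (c : B) (H : ∀ a ∈ A, c * a ∈ S)
    {z : B} (hz : z ∈ Submodule.span R A) : c * z ∈ S :=
  (Submodule.span_le (p := S.comap (LinearMap.mulLeft R c))).2 H hz

theorem mul_mem_of_span_right {A : Set B} {S : Submodule R B} (c : B) (H : ∀ a ∈ A, a * c ∈ S)
    {z : B} (hz : z ∈ Submodule.span R A) : z * c ∈ S :=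
  (Submodule.span_le (p := S.comap (LinearMap.mulRight R c))).2 H hz

namespace Rels

theorem s_x (h : Rels ω v s e x y) : s * x = y * s + e - 1 := by
  rw [add_sub_assoc, ← h.skein_left]; abel

theorem s_y (h : Rels ω v s e x y) : s * y = x * s - e + 1 := by
  have := h.skein_right
  rw [sub_add, ← this]; abel

theorem x_s (h : Rels ω v s e x y) : x * s = s * y + e - 1 := by
  rw [add_sub_assoc, ← h.skein_right]; abel

theorem y_e (h : Rels ω v s e x y) : y * e = -(x * e) := by
  have := h.antisymm_right
  rw [add_mul] at this
  exact eq_neg_of_add_eq_zero_right this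

theorem e_y (h : Rels ω v s e x y) : e * y = -(e * x) := by
  have := h.antisymm_left
  rw [mul_add] at this
  exact eq_neg_of_add_eq_zero_right this

theorem y_xpow (h : Rels ω v s e x y) (n : ℕ) : y * x ^ n = x ^ n * y :=
  (Commute.pow_left h.x_comm n).eq.symm

theorem y_xpow_e (h : Rels ω v s e x y) (n : ℕ) : y * (x ^ n * e) = -(x ^ (n + 1) * e) := by
  rw [← mul_assoc, h.y_xpow, mul_assoc, h.y_e, mul_neg, pow_succ, mul_assoc]

theorem cyc_sum (h : Rels ω v s e x y) :
    ∑ j ∈ Finset.range (r + 1), (cycPoly v).coeff j • x ^ j = 0 := by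
  rw [← aeval_cycPoly, h.cyc]

theorem x_pow_r (h : Rels ω v s e x y) :
    x ^ r = -∑ j ∈ Finset.range r, (cycPoly v).coeff j • x ^ j := by
  have := h.cyc_sum
  rw [Finset.sum_range_succ, cycPoly_coeff_top, one_smul] at this
  exact eq_neg_of_add_eq_zero_right this

theorem xpow_mul_mem (h : Rels ω v s e x y) {S : Submodule R B} {z : B}
    (H : ∀ a < r, x ^ a * z ∈ S) (n : ℕ) : x ^ n * z ∈ S := by
  induction n using Nat.strong_induction_on with
  | _ n ih =>
    rcases lt_or_ge n r with hn | hn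
    · exact H n hn
    · obtain ⟨k, rfl⟩ := Nat.exists_eq_add_of_le' hn
      rw [pow_add, h.x_pow_r, mul_neg, Finset.mul_sum, neg_mul, Finset.sum_mul]
      refine S.neg_mem (S.sum_mem fun j hj => ?_)
      rw [mul_smul_comm, smul_mul_assoc, ← pow_add]
      exact S.smul_mem _ (ih _ (by have := Finset.mem_range.1 hj; omega))

theorem mul_xpow_mem (h : Rels ω v s e x y) {S : Submodule R B} {z : B}
    (H : ∀ a < r, z * x ^ a ∈ S) (n : ℕ) : z * x ^ n ∈ S := by
  induction n using Nat.strong_induction_on with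
  | _ n ih =>
    rcases lt_or_ge n r with hn | hn
    · exact H n hn
    · obtain ⟨k, rfl⟩ := Nat.exists_eq_add_of_le' hn
      rw [pow_add, h.x_pow_r, mul_neg, Finset.mul_sum, mul_neg, Finset.mul_sum]
      refine S.neg_mem (S.sum_mem fun j hj => ?_)
      rw [mul_smul_comm, mul_smul_comm, ← pow_add]
      exact S.smul_mem _ (ih _ (by have := Finset.mem_range.1 hj; omega))

end Rels

/-- The span of the elements `x^a e x^b`. -/
def eSpan (R : Type*) [CommRing R] {B : Type*} [Ring B] [Algebra R B] (e x : B) :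
    Submodule R B :=
  Submodule.span R {z | ∃ a b : ℕ, z = x ^ a * e * x ^ b}

/-- The span of the elements `x^a e x^b` and of the elements `x^a y^b s^c` with `b < n`. -/
def filtSpan (R : Type*) [CommRing R] {B : Type*} [Ring B] [Algebra R B] (s e x y : B) (n : ℕ) :
    Submodule R B :=
  eSpan R e x ⊔ Submodule.span R {z | ∃ a b c : ℕ, b < n ∧ z = x ^ a * y ^ b * s ^ c}

theorem mem_eSpan (a b : ℕ) : x ^ a * e * x ^ b ∈ eSpan R e x :=
  Submodule.subset_span ⟨a, b, rfl⟩

theorem eSpan_le_filtSpan (n : ℕ) : eSpan R e x ≤ filtSpan R s e x y n := le_sup_left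

theorem mem_filtSpan {n : ℕ} (a c : ℕ) {b : ℕ} (hb : b < n) :
    x ^ a * y ^ b * s ^ c ∈ filtSpan R s e x y n :=
  Submodule.mem_sup_right (Submodule.subset_span ⟨a, b, c, hb, rfl⟩)

theorem filtSpan_induction {n : ℕ} {P : B → Prop} (hJ : ∀ z ∈ eSpan R e x, P z)
    (hm : ∀ a b c : ℕ, b < n → P (x ^ a * y ^ b * s ^ c)) (h0 : P 0)
    (hadd : ∀ z w, P z → P w → P (z + w)) (hsmul : ∀ (k : R) z, P z → P (k • z))
    {z : B} (hz : z ∈ filtSpan R s e x y n) : P z := by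
  obtain ⟨z₁, hz₁, z₂, hz₂, rfl⟩ := Submodule.mem_sup.1 hz
  refine hadd _ _ (hJ _ hz₁) (Submodule.span_induction ?_ h0 (fun z w _ _ => hadd z w)
    (fun k z _ => hsmul k z) hz₂)
  rintro _ ⟨a, b, c, hb, rfl⟩
  exact hm a b c hb

theorem filtSpan_mul_left {m : ℕ} {S : Submodule R B} (d : B)
    (hJ : ∀ z ∈ eSpan R e x, d * z ∈ S)
    (hm : ∀ a b c : ℕ, b < m → d * (x ^ a * y ^ b * s ^ c) ∈ S)
    {z : B} (hz : z ∈ filtSpan R s e x y m) : d * z ∈ S :=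
  filtSpan_induction (P := fun z => d * z ∈ S) hJ hm (by simp)
    (fun z w hz hw => by rw [mul_add]; exact S.add_mem hz hw)
    (fun k z hz => by rw [mul_smul_comm]; exact S.smul_mem _ hz) hz

theorem filtSpan_mono {m n : ℕ} (h : m ≤ n) : filtSpan R s e x y m ≤ filtSpan R s e x y n :=
  fun _ hz => filtSpan_induction (P := fun z => z ∈ filtSpan R s e x y n)
    (fun _ hz => eSpan_le_filtSpan n hz) (fun a _ c hb => mem_filtSpan a c (hb.trans_le h))
    (Submodule.zero_mem _) (fun _ _ => Submodule.add_mem _)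
    (fun k _ => Submodule.smul_mem _ k) hz

namespace Rels

theorem x_mul_eSpan {z : B} (hz : z ∈ eSpan R e x) : x * z ∈ eSpan R e x := by
  refine mul_mem_of_span_left x ?_ hz
  rintro _ ⟨a, b, rfl⟩
  rw [← mul_assoc, ← mul_assoc, ← pow_succ']
  exact mem_eSpan _ _

theorem y_mul_eSpan (h : Rels ω v s e x y) {z : B} (hz : z ∈ eSpan R e x) :
    y * z ∈ eSpan R e x := by
  refine mul_mem_of_span_left y ?_ hz
  rintro _ ⟨a, b, rfl⟩
  rw [← mul_assoc, h.y_xpow_e, neg_mul]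
  exact Submodule.neg_mem _ (mem_eSpan _ _)

theorem e_mul_eSpan (h : Rels ω v s e x y) {z : B} (hz : z ∈ eSpan R e x) :
    e * z ∈ eSpan R e x := by
  refine mul_mem_of_span_left e ?_ hz
  rintro _ ⟨a, b, rfl⟩
  rw [← mul_assoc, ← mul_assoc, h.unwrap, smul_mul_assoc]
  simpa using Submodule.smul_mem _ _ (mem_eSpan (R := R) (e := e) (x := x) 0 b)

theorem s_mul_eSpan (h : Rels ω v s e x y) {z : B} (hz : z ∈ eSpan R e x) :
    s * z ∈ eSpan R e x := by
  refine mul_mem_of_span_left s ?_ hz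
  rintro _ ⟨a, b, rfl⟩
  induction a with
  | zero => simpa [← mul_assoc, h.s_e] using mem_eSpan (R := R) (e := e) (x := x) 0 b
  | succ a ih =>
    have : s * (x ^ (a + 1) * e * x ^ b) = y * (s * (x ^ a * e * x ^ b))
        + e * (x ^ a * e * x ^ b) - x ^ a * e * x ^ b := by
      calc _ = (s * x) * (x ^ a * e * x ^ b) := by rw [pow_succ']; simp only [mul_assoc]
        _ = _ := by rw [h.s_x, sub_mul, add_mul, one_mul]; simp only [mul_assoc]
    rw [this]
    exact Submodule.sub_mem _ (Submodule.add_mem _ (h.y_mul_eSpan ih) (h.e_mul_eSpan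
      (mem_eSpan _ _))) (mem_eSpan _ _)

theorem eSpan_mul_x {z : B} (hz : z ∈ eSpan R e x) : z * x ∈ eSpan R e x := by
  refine mul_mem_of_span_right x ?_ hz
  rintro _ ⟨a, b, rfl⟩
  rw [mul_assoc, ← pow_succ]
  exact mem_eSpan _ _

theorem eSpan_mul_y (h : Rels ω v s e x y) {z : B} (hz : z ∈ eSpan R e x) :
    z * y ∈ eSpan R e x := by
  refine mul_mem_of_span_right y ?_ hz
  rintro _ ⟨a, b, rfl⟩
  have : x ^ a * e * x ^ b * y = -(x ^ a * e * x ^ (b + 1)) := by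
    rw [mul_assoc, ← h.y_xpow, mul_assoc, ← mul_assoc e, h.e_y, pow_succ']
    simp only [neg_mul, mul_neg, mul_assoc]
  rw [this]
  exact Submodule.neg_mem _ (mem_eSpan _ _)

theorem eSpan_mul_s (h : Rels ω v s e x y) {z : B} (hz : z ∈ eSpan R e x) :
    z * s ∈ eSpan R e x := by
  refine mul_mem_of_span_right s ?_ hz
  rintro _ ⟨a, b, rfl⟩
  induction b with
  | zero => simpa [mul_assoc, h.e_s] using mem_eSpan (R := R) (e := e) (x := x) a 0
  | succ b ih =>
    have : x ^ a * e * x ^ (b + 1) * s = x ^ a * e * x ^ b * s * y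
        + ω b • (x ^ a * e * x ^ 0) - x ^ a * e * x ^ b := by
      calc _ = x ^ a * e * x ^ b * (x * s) := by rw [pow_succ]; simp only [mul_assoc]
        _ = x ^ a * e * x ^ b * s * y + x ^ a * (e * x ^ b * e) - x ^ a * e * x ^ b := by
          rw [h.x_s, mul_sub, mul_add, mul_one]; simp only [mul_assoc]
        _ = _ := by rw [h.unwrap, mul_smul_comm, pow_zero, mul_one]
    rw [this]
    exact Submodule.sub_mem _ (Submodule.add_mem _ (h.eSpan_mul_y ih)
      (Submodule.smul_mem _ _ (mem_eSpan _ _))) (mem_eSpan _ _)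

theorem eSpan_mul_pow {c : B} (H : ∀ z ∈ eSpan R e x, z * c ∈ eSpan R e x) (n : ℕ) {z : B}
    (hz : z ∈ eSpan R e x) : z * c ^ n ∈ eSpan R e x := by
  induction n with
  | zero => simpa
  | succ n ih => rw [pow_succ, ← mul_assoc]; exact H _ ih

theorem e_mul_monomial (h : Rels ω v s e x y) (a b c : ℕ) :
    e * (x ^ a * y ^ b * s ^ c) ∈ eSpan R e x := by
  have he : e ∈ eSpan R e x := by simpa using mem_eSpan (R := R) (e := e) (x := x) 0 0
  rw [← mul_assoc, ← mul_assoc]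
  exact eSpan_mul_pow (fun _ => h.eSpan_mul_s) c (eSpan_mul_pow (fun _ => h.eSpan_mul_y) b
    (eSpan_mul_pow (fun _ => eSpan_mul_x) a he))

theorem x_mul_filtSpan (n : ℕ) {z : B} (hz : z ∈ filtSpan R s e x y n) :
    x * z ∈ filtSpan R s e x y n := by
  refine filtSpan_mul_left x (fun z hz => eSpan_le_filtSpan _ (x_mul_eSpan hz)) ?_ hz
  intro a b c hb
  rw [← mul_assoc, ← mul_assoc, ← pow_succ']
  exact mem_filtSpan _ _ hb

theorem y_mul_filtSpan (h : Rels ω v s e x y) (n : ℕ) {z : B} (hz : z ∈ filtSpan R s e x y n) :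
    y * z ∈ filtSpan R s e x y (n + 1) := by
  refine filtSpan_mul_left y (fun z hz => eSpan_le_filtSpan _ (h.y_mul_eSpan hz)) ?_ hz
  intro a b c hb
  rw [← mul_assoc, ← mul_assoc, h.y_xpow, mul_assoc (x ^ a), ← pow_succ']
  exact mem_filtSpan _ _ (by omega)

theorem ypow_mul_filtSpan (h : Rels ω v s e x y) (k n : ℕ) {z : B}
    (hz : z ∈ filtSpan R s e x y n) : y ^ k * z ∈ filtSpan R s e x y (n + k) := by
  induction k with
  | zero => simpa
  | succ k ih => rw [pow_succ', mul_assoc]; exact h.y_mul_filtSpan _ ih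

theorem xpow_mul_filtSpan (k n : ℕ) {z : B}
    (hz : z ∈ filtSpan R s e x y n) : x ^ k * z ∈ filtSpan R s e x y n := by
  induction k with
  | zero => simpa
  | succ k ih => rw [pow_succ', mul_assoc]; exact x_mul_filtSpan _ ih

theorem filtSpan_mul_s (h : Rels ω v s e x y) (n : ℕ) {z : B} (hz : z ∈ filtSpan R s e x y n) :
    z * s ∈ filtSpan R s e x y n := by
  refine filtSpan_induction (P := fun z => z * s ∈ filtSpan R s e x y n)
    (fun z hz => eSpan_le_filtSpan _ (h.eSpan_mul_s hz)) ?_ (by simp)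
    (fun z w hz hw => by rw [add_mul]; exact Submodule.add_mem _ hz hw)
    (fun k z hz => by rw [smul_mul_assoc]; exact Submodule.smul_mem _ _ hz) hz
  intro a b c hb
  rw [mul_assoc, ← pow_succ]
  exact mem_filtSpan _ _ hb

theorem filtSpan_mul_spow (h : Rels ω v s e x y) (k n : ℕ) {z : B}
    (hz : z ∈ filtSpan R s e x y n) : z * s ^ k ∈ filtSpan R s e x y n := by
  induction k with
  | zero => simpa
  | succ k ih => rw [pow_succ, ← mul_assoc]; exact h.filtSpan_mul_s _ ih

/-- The skein relation says that s exchanges x and y up to e - 1; iterating it, the error stays of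
lower degree in y modulo the ideal of e. -/
theorem s_xpow_sub_mem (h : Rels ω v s e x y) (n : ℕ) :
    s * x ^ n - y ^ n * s ∈ filtSpan R s e x y n := by
  induction n with
  | zero => simp
  | succ n ih =>
    have : s * x ^ (n + 1) - y ^ (n + 1) * s = y * (s * x ^ n - y ^ n * s)
        + e * (x ^ n * y ^ 0 * s ^ 0) - x ^ n * y ^ 0 * s ^ 0 := by
      calc _ = (s * x) * x ^ n - y ^ (n + 1) * s := by rw [pow_succ' x, mul_assoc]
        _ = _ := by
          rw [h.s_x, pow_succ' y, sub_mul, add_mul, mul_sub]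
          simp only [mul_assoc, one_mul, pow_zero, mul_one]
          abel
    rw [this]
    exact Submodule.sub_mem _ (Submodule.add_mem _ (h.y_mul_filtSpan _ ih)
      (eSpan_le_filtSpan _ (h.e_mul_monomial n 0 0))) (mem_filtSpan _ _ n.succ_pos)

/-- Only x has a cyclotomic relation by definition. Conjugating it by s yields one for y, with
leading term y^r since p is monic. -/
theorem ypow_r_mem (h : Rels ω v s e x y) : y ^ r ∈ filtSpan R s e x y r := by
  -- This is s p(x) s = 0, with each s x^j s written as y^j plus an error of y-degree below j.
  have key : ∑ j ∈ Finset.range (r + 1), (cycPoly v).coeff j •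
      (y ^ j + (s * x ^ j - y ^ j * s) * s) = 0 := by
    have h2 : ∀ j, y ^ j + (s * x ^ j - y ^ j * s) * s = s * x ^ j * s := fun j => by
      rw [sub_mul, mul_assoc (y ^ j), h.s_sq, mul_one, add_sub_cancel]
    have h3 : s * (∑ j ∈ Finset.range (r + 1), (cycPoly v).coeff j • x ^ j) * s = 0 := by
      rw [h.cyc_sum, mul_zero, zero_mul]
    simp only [h2]
    simpa [Finset.mul_sum, Finset.sum_mul] using h3
  rw [Finset.sum_range_succ, cycPoly_coeff_top, one_smul, ← add_assoc, add_right_comm] at key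
  rw [eq_neg_of_add_eq_zero_right key]
  refine Submodule.neg_mem _ (Submodule.add_mem _ (Submodule.sum_mem _ fun j hj =>
    Submodule.smul_mem _ _ (Submodule.add_mem _ ?_ ?_)) ?_)
  · simpa using mem_filtSpan (R := R) (s := s) (e := e) (x := x) (y := y) 0 0
      (Finset.mem_range.1 hj)
  · exact h.filtSpan_mul_s _ (filtSpan_mono (Finset.mem_range.1 hj).le (h.s_xpow_sub_mem j))
  · exact h.filtSpan_mul_s _ (h.s_xpow_sub_mem r)

theorem filtSpan_le (h : Rels ω v s e x y) (n : ℕ) :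
    filtSpan R s e x y (r + n) ≤ filtSpan R s e x y r := by
  induction n with
  | zero => exact le_rfl
  | succ n ih =>
    refine le_trans (fun z hz => ?_) ih
    refine filtSpan_induction (P := fun z => z ∈ filtSpan R s e x y (r + n))
      (fun _ hz => eSpan_le_filtSpan _ hz) (fun a b c hb => ?_)
      (Submodule.zero_mem _) (fun _ _ => Submodule.add_mem _)
      (fun k _ => Submodule.smul_mem _ k) hz
    rcases Nat.lt_or_ge b (r + n) with hb' | hb'
    · exact mem_filtSpan _ _ hb'
    · obtain rfl : b = n + r := by omega
      rw [mul_assoc, pow_add, mul_assoc]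
      refine xpow_mul_filtSpan _ _ ?_
      rw [← mul_assoc]
      exact h.filtSpan_mul_spow _ _ (h.ypow_mul_filtSpan _ _ h.ypow_r_mem)

theorem monomial_mem (h : Rels ω v s e x y) (a b c : ℕ) :
    x ^ a * y ^ b * s ^ c ∈ filtSpan R s e x y r :=
  h.filtSpan_le (b + 1) (mem_filtSpan _ _ (by omega))

theorem y_mul_filtSpan_r (h : Rels ω v s e x y) {z : B} (hz : z ∈ filtSpan R s e x y r) :
    y * z ∈ filtSpan R s e x y r :=
  h.filtSpan_le 1 (h.y_mul_filtSpan r hz)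

theorem s_mul_filtSpan (h : Rels ω v s e x y) {z : B} (hz : z ∈ filtSpan R s e x y r) :
    s * z ∈ filtSpan R s e x y r := by
  refine filtSpan_mul_left s (fun z hz => eSpan_le_filtSpan _ (h.s_mul_eSpan hz)) ?_ hz
  intro a b c _
  induction a with
  | zero =>
    induction b with
    | zero => simpa [← pow_succ'] using h.monomial_mem 0 0 (c + 1)
    | succ b ih =>
      have : s * (x ^ 0 * y ^ (b + 1) * s ^ c) = x * (s * (x ^ 0 * y ^ b * s ^ c))
          - e * (x ^ 0 * y ^ b * s ^ c) + x ^ 0 * y ^ b * s ^ c := by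
        simp only [pow_zero, one_mul]
        calc _ = (s * y) * (y ^ b * s ^ c) := by rw [pow_succ']; simp only [mul_assoc]
          _ = _ := by rw [h.s_y, add_mul, sub_mul, one_mul]; simp only [mul_assoc]
      rw [this]
      exact Submodule.add_mem _ (Submodule.sub_mem _ (x_mul_filtSpan _ (ih (by omega)))
        (eSpan_le_filtSpan _ (h.e_mul_monomial _ _ _))) (h.monomial_mem _ _ _)
  | succ a ih =>
    have : s * (x ^ (a + 1) * y ^ b * s ^ c) = y * (s * (x ^ a * y ^ b * s ^ c))
        + e * (x ^ a * y ^ b * s ^ c) - x ^ a * y ^ b * s ^ c := by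
      calc _ = (s * x) * (x ^ a * y ^ b * s ^ c) := by rw [pow_succ']; simp only [mul_assoc]
        _ = _ := by rw [h.s_x, sub_mul, add_mul, one_mul]; simp only [mul_assoc]
    rw [this]
    exact Submodule.sub_mem _ (Submodule.add_mem _ (h.y_mul_filtSpan_r ih)
      (eSpan_le_filtSpan _ (h.e_mul_monomial _ _ _))) (h.monomial_mem _ _ _)

theorem e_mul_filtSpan (h : Rels ω v s e x y) {z : B} (hz : z ∈ filtSpan R s e x y r) :
    e * z ∈ filtSpan R s e x y r :=
  filtSpan_mul_left e (fun _ hz => eSpan_le_filtSpan _ (h.e_mul_eSpan hz))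
    (fun a b c _ => eSpan_le_filtSpan _ (h.e_mul_monomial a b c)) hz

end Rels

theorem filtSpan_eq_top (ω : ℕ → R) (v : Fin r → R) :
    filtSpan R (s₁ ω v) (e₁ ω v) (x₁ ω v) (x₂ ω v) r = ⊤ := by
  have h := W₂.rels ω v
  refine W₂.eq_top _ ?_ (fun _ => h.s_mul_filtSpan) (fun _ => h.e_mul_filtSpan)
    (fun _ => Rels.x_mul_filtSpan r) (fun _ => h.y_mul_filtSpan_r)
  simpa using h.monomial_mem 0 0 0

/-- The family of `3 r ^ 2` elements spans the two-strand algebra, for all parameters. -/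
theorem span_algebraFamily (ω : ℕ → R) (v : Fin r → R) :
    Submodule.span R (Set.range (algebraFamily ω v)) = ⊤ := by
  have h := W₂.rels ω v
  set S := Submodule.span R (Set.range (algebraFamily ω v)) with hS
  have hmem (i) : algebraFamily ω v i ∈ S := Submodule.subset_span ⟨i, rfl⟩
  rw [eq_top_iff, ← filtSpan_eq_top]
  refine sup_le (Submodule.span_le.2 ?_) (Submodule.span_le.2 ?_)
  · rintro _ ⟨a, b, rfl⟩
    refine h.mul_xpow_mem (fun b hb => ?_) b
    rw [mul_assoc]
    refine h.xpow_mul_mem (fun a ha => ?_) a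
    rw [← mul_assoc]
    exact hmem (Sum.inl (⟨a, ha⟩, ⟨b, hb⟩))
  · rintro _ ⟨a, b, c, hb, rfl⟩
    rw [mul_assoc]
    refine h.xpow_mul_mem (fun a ha => ?_) a
    rw [← mul_assoc]
    rcases Nat.even_or_odd' c with ⟨k, rfl | rfl⟩
    · rw [pow_mul, pow_two, h.s_sq, one_pow, mul_one]
      exact hmem (Sum.inr (Sum.inr (⟨a, ha⟩, ⟨b, hb⟩)))
    · rw [pow_succ, pow_mul, pow_two, h.s_sq, one_pow, one_mul]
      exact hmem (Sum.inr (Sum.inl (⟨a, ha⟩, ⟨b, hb⟩)))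

end Span

/-! ### Independence of the ideal family forces admissibility. -/

section Necessity

variable {R : Type*} [CommRing R] {ω : ℕ → R} {r : ℕ} {v : Fin r → R}

theorem idealFamily_of_algebraFamily (hr : 1 ≤ r)
    (h : LinearIndependent R (algebraFamily ω v)) : LinearIndependent R (idealFamily ω v) := by
  have := h.comp (fun a : Fin r => Sum.inl (a, (⟨0, hr⟩ : Fin r)))
    (fun a b hab => by simpa using hab)
  convert this using 1
  funext a
  simp [idealFamily, algebraFamily]

/-- Each use of s x = y s + e - 1 leaves three terms, and y acts on x^k e as -x. The e-terms unwrap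
to the ω's; the terms -1 all land on x^(n-1) e with alternating signs, so they sum to the parity
indicator. -/
theorem Rels.s_xpow_e {B : Type*} [Ring B] [Algebra R B] {s e x y : B} (h : Rels ω v s e x y)
    (n : ℕ) : s * (x ^ n * e) = ((-1 : R) ^ n) • (x ^ n * e)
      + ∑ i ∈ Finset.range n, (((-1) ^ i * ω (n - 1 - i)) • (x ^ i * e))
      - (if Odd n then (1 : R) else 0) • (x ^ (n - 1) * e) := by
  induction n with
  | zero => simp [h.s_e]
  | succ n ih =>
    have h1 : s * (x ^ (n + 1) * e) = y * (s * (x ^ n * e)) + ω n • (x ^ 0 * e) - x ^ n * e := by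
      rw [pow_zero, one_mul, ← h.unwrap]
      calc _ = (s * x) * (x ^ n * e) := by rw [pow_succ']; simp only [mul_assoc]
        _ = _ := by rw [h.s_x, sub_mul, add_mul, one_mul]; simp only [mul_assoc]
    -- For n = 0 the exponent n - 1 is truncated, but the indicator vanishes.
    have h2 : y * ((if Odd n then (1 : R) else 0) • (x ^ (n - 1) * e))
        = -((if Odd n then (1 : R) else 0) • (x ^ n * e)) := by
      rw [mul_smul_comm, h.y_xpow_e, smul_neg]
      rcases n with _ | n
      · simp
      · simp
    rw [h1, ih, mul_sub, h2, mul_add, mul_smul_comm, h.y_xpow_e, Finset.mul_sum,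
      Finset.sum_range_succ']
    have h3 : ∀ i ∈ Finset.range n, y * (((-1 : R) ^ i * ω (n - 1 - i)) • (x ^ i * e))
        = ((-1) ^ (i + 1) * ω (n + 1 - 1 - (i + 1))) • (x ^ (i + 1) * e) := by
      intro i _
      rw [mul_smul_comm, h.y_xpow_e, smul_neg, ← neg_smul, pow_succ,
        show n + 1 - 1 - (i + 1) = n - 1 - i by omega]
      congr 1; ring
    rw [Finset.sum_congr rfl h3]
    have h4 : (if Odd (n + 1) then (1 : R) else 0) = 1 - (if Odd n then (1 : R) else 0) := by
      by_cases hn : Odd n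
      · simp [hn, Nat.odd_add_one]
      · simp [hn, Nat.odd_add_one]
    rw [h4]
    simp only [pow_zero, one_mul, Nat.add_sub_cancel, Nat.sub_zero]
    module

theorem admissible_of_idealFamily (hr : 1 ≤ r) (h : LinearIndependent R (idealFamily ω v)) :
    Admissible ω v := by
  have hW := W₂.rels ω v
  set s := s₁ ω v
  set e := e₁ ω v with he
  set x := x₁ ω v with hx
  have hind (c : ℕ → R) (hc : ∑ j ∈ Finset.range r, c j • (x ^ j * e) = 0) :
      ∀ j < r, c j = 0 := by
    rw [Finset.sum_range] at hc
    intro j hj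
    exact Fintype.linearIndependent_iff.1 h (fun i => c i) hc ⟨j, hj⟩
  have htor (c : R) (hc : c • e = 0) : c = 0 := by
    refine hind (fun j => if j = 0 then c else 0) ?_ 0 hr
    rw [Finset.sum_eq_single 0] <;> simp +contextual [hc]
  have hpe : ∑ n ∈ Finset.range (r + 1), (cycPoly v).coeff n • (x ^ n * e) = 0 := by
    have := congrArg (· * e) hW.cyc_sum
    simpa [Finset.sum_mul] using this
  refine ⟨fun j hj => ?_, fun a => ?_⟩
  · let a := fun n => (cycPoly v).coeff n
    have hsp : ∑ n ∈ Finset.range (r + 1), a n • (s * (x ^ n * e)) = 0 := by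
      have := congrArg (s * ·) hpe
      simpa [Finset.mul_sum] using this
    -- The coefficient of x^j e in s p(x) e - (-1)^r p(x) e. The subtracted multiple cancels the
    -- term in x^r e, so only members of the independent family remain.
    let d : ℕ → R := fun j => (-1) ^ j * a j - (-1) ^ r * a j
      + (-1) ^ j * ∑ μ ∈ Finset.range (r - j), ω μ * a (μ + j + 1)
      - (if Even j then 1 else 0) * a (j + 1)
    have hd : ∑ j ∈ Finset.range r, d j • (x ^ j * e) = 0 := by
      have e1 : ∑ n ∈ Finset.range (r + 1), a n • (((-1 : R) ^ n) • (x ^ n * e))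
          = ∑ n ∈ Finset.range r, ((-1) ^ n * a n - (-1) ^ r * a n) • (x ^ n * e) := by
        have : ∑ n ∈ Finset.range (r + 1), ((-1 : R) ^ r) • (a n • (x ^ n * e)) = 0 := by
          rw [← Finset.smul_sum, hpe, smul_zero]
        rw [← sub_zero (∑ n ∈ Finset.range (r + 1), _), ← this, ← Finset.sum_sub_distrib,
          Finset.sum_range_succ]
        rw [smul_comm (a r), sub_self, add_zero]
        refine Finset.sum_congr rfl fun n _ => ?_
        rw [sub_smul, mul_smul, mul_smul, smul_comm]
      have e2 : ∑ n ∈ Finset.range (r + 1), a n •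
          ∑ i ∈ Finset.range n, (((-1) ^ i * ω (n - 1 - i)) • (x ^ i * e))
          = ∑ j ∈ Finset.range r, ((-1) ^ j * ∑ μ ∈ Finset.range (r - j),
              ω μ * a (μ + j + 1)) • (x ^ j * e) := by
        simp only [Finset.smul_sum, Finset.mul_sum, Finset.sum_smul]
        rw [Finset.sum_sigma', Finset.sum_sigma']
        refine Finset.sum_bij' (fun p _ => ⟨p.2, p.1 - 1 - p.2⟩)
          (fun p _ => ⟨p.2 + p.1 + 1, p.1⟩) ?_ ?_ ?_ ?_ ?_
        · rintro ⟨n, i⟩ hn; simp at hn ⊢; omega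
        · rintro ⟨n, i⟩ hn; simp at hn ⊢; omega
        · rintro ⟨n, i⟩ hn
          simp only [Finset.mem_sigma, Finset.mem_range] at hn
          simp only [Sigma.mk.injEq, heq_eq_eq, and_true]
          omega
        · rintro ⟨n, i⟩ hn
          simp only [Finset.mem_sigma, Finset.mem_range] at hn
          simp only [Sigma.mk.injEq, heq_eq_eq, true_and]
          omega
        · rintro ⟨n, i⟩ hn
          simp only [Finset.mem_sigma, Finset.mem_range] at hn
          rw [smul_smul, show n - 1 - i + i + 1 = n by omega]
          congr 1; ring
      have e3 : ∑ n ∈ Finset.range (r + 1), a n •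
          ((if Odd n then (1 : R) else 0) • (x ^ (n - 1) * e))
          = ∑ j ∈ Finset.range r, ((if Even j then 1 else 0) * a (j + 1)) • (x ^ j * e) := by
        rw [Finset.sum_range_succ']
        simp [Nat.odd_add_one]
      simp only [hW.s_xpow_e, smul_add, smul_sub, Finset.sum_add_distrib,
        Finset.sum_sub_distrib] at hsp
      rw [e1, e2, e3] at hsp
      simp only [d, add_smul, sub_smul, Finset.sum_add_distrib, Finset.sum_sub_distrib] at hsp ⊢
      exact hsp
    have hj0 := hind d hd j hj
    have hsum : ∑ μ ∈ Finset.range (r - j), ω μ * signedEsymm v (μ + j + 1)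
        = ∑ μ ∈ Finset.range (r - j), ω μ * a (μ + j + 1) :=
      Finset.sum_congr rfl fun μ hμ => by
        rw [signedEsymm_eq_coeff v (by have := Finset.mem_range.1 hμ; omega)]
    rw [hsum, signedEsymm_eq_coeff v hj.le, signedEsymm_eq_coeff v hj]
    simp only [d] at hj0
    obtain ⟨k, rfl⟩ := Nat.exists_eq_add_of_le hj.le
    rw [Nat.add_sub_cancel_left] at hj0 ⊢
    rcases Nat.even_or_odd j with hjp | hjp <;> rcases Nat.even_or_odd k with hk | hk <;>
        simp [pow_add, hjp.neg_one_pow, hk.neg_one_pow, hjp, hk, Nat.not_even_iff_odd.2,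
        Nat.not_odd_iff_even.2] at hj0 ⊢ <;> 
        first | linear_combination hj0 | linear_combination -hj0
  -- The coefficient of e in e x^a p(x) e = 0, after unwrapping.
  · apply htor
    have := congrArg (e * x ^ a * ·) hpe
    simp only [Finset.mul_sum, mul_zero, mul_smul_comm] at this
    rw [Finset.sum_smul, ← this]
    refine Finset.sum_congr rfl fun n hn => ?_
    rw [signedEsymm_eq_coeff v (by have := Finset.mem_range.1 hn; omega), ← mul_assoc,
      mul_assoc e, ← pow_add, hW.unwrap, smul_smul, add_comm]

end Necessity

/-! ### Generating functions: admissibility, existence, uniqueness and u-admissibility. -/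

section GeneratingFunctions

open PowerSeries

variable {R : Type*} [CommRing R] {r : ℕ}

/-- The power series `∏ (1 - v_i t)`. -/
noncomputable def elemNeg (v : Fin r → R) : R⟦X⟧ := ∏ i, (1 - C (v i) * X)

/-- The power series `∏ (1 + v_i t)`. -/
noncomputable def elemPos (v : Fin r → R) : R⟦X⟧ := ∏ i, (1 + C (v i) * X)

theorem constantCoeff_elemNeg (v : Fin r → R) : constantCoeff (elemNeg v) = 1 := by
  simp [elemNeg, map_prod]

theorem coeff_elemPos (v : Fin r → R) (n : ℕ) :
    coeff n (elemPos v) = (-1) ^ n * coeff n (elemNeg v) := by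
  have : elemPos v = rescale (-1 : R) (elemNeg v) := by
    have hC (a : R) : rescale (-1 : R) (C a) = C a := by
      ext n
      rw [coeff_rescale, coeff_C]
      split_ifs with h <;> simp [h]
    simp [elemPos, elemNeg, map_prod, rescale_X, hC]
  rw [this, coeff_rescale]

theorem reflect_cycPoly : ∀ {r : ℕ} (v : Fin r → R), Polynomial.reflect r (cycPoly v)
    = ∏ i, (1 - Polynomial.C (v i) * Polynomial.X)
  | 0, v => by simp [cycPoly]
  | r + 1, v => by
    have h := Polynomial.reflect_mul (Polynomial.X - Polynomial.C (v 0))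
      (cycPoly fun i : Fin r => v i.succ) (Polynomial.natDegree_X_sub_C_le _)
      (cycPoly_natDegree_le _)
    have h1 : Polynomial.reflect 1 (Polynomial.X - Polynomial.C (v 0))
        = 1 - Polynomial.C (v 0) * Polynomial.X := by
      rw [Polynomial.reflect_sub, Polynomial.reflect_C, pow_one, Polynomial.reflect_one_X]
    rw [Fin.prod_univ_succ, ← reflect_cycPoly, ← h1, ← h, cycPoly, Fin.prod_univ_succ,
      Nat.add_comm 1 r]
    rfl

theorem coeff_elemNeg_eq (v : Fin r → R) (n : ℕ) :
    coeff n (elemNeg v) = (Polynomial.reflect r (cycPoly v)).coeff n := by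
  have : elemNeg v = ((Polynomial.reflect r (cycPoly v) : Polynomial R) : R⟦X⟧) := by
    rw [reflect_cycPoly, ← Polynomial.coeToPowerSeries.ringHom_apply, map_prod]
    simp [elemNeg]
  rw [this, Polynomial.coeff_coe]

theorem coeff_elemNeg_of_le (v : Fin r → R) {n : ℕ} (hn : n ≤ r) :
    coeff n (elemNeg v) = signedEsymm v (r - n) := by
  rw [coeff_elemNeg_eq, Polynomial.coeff_reflect, Polynomial.revAt_le hn,
    signedEsymm_eq_coeff v (Nat.sub_le _ _)]

theorem coeff_elemNeg_of_lt (v : Fin r → R) {n : ℕ} (hn : r < n) : coeff n (elemNeg v) = 0 := by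
  rw [coeff_elemNeg_eq, Polynomial.coeff_reflect, Polynomial.revAt_eq_self_of_lt hn]
  exact Polynomial.coeff_eq_zero_of_natDegree_lt ((cycPoly_natDegree_le v).trans_lt hn)

/-- Admissibility in terms of generating functions. -/
theorem admissible_iff_coeff (ω : ℕ → R) (v : Fin r → R) :
    Admissible ω v ↔ ∀ n, coeff n (mk ω * elemNeg v)
      = -2 * (if Even n then 1 else 0) * coeff (n + 1) (elemNeg v)
        + (if Odd (r + n) then 1 else 0) * coeff n (elemNeg v) := by
  -- Coefficients n < r match the first conditions under j = r - 1 - n; coefficients r + a match the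
  -- second ones.
  have hlow (n : ℕ) (hn : n < r) : coeff n (mk ω * elemNeg v)
      = ∑ μ ∈ Finset.range (r - (r - 1 - n)), ω μ * signedEsymm v (μ + (r - 1 - n) + 1) := by
    rw [coeff_mul, Finset.Nat.sum_antidiagonal_eq_sum_range_succ_mk,
      show r - (r - 1 - n) = n.succ by omega]
    refine Finset.sum_congr rfl fun μ hμ => ?_
    have := Finset.mem_range.1 hμ
    rw [coeff_mk, coeff_elemNeg_of_le v (by omega)]
    congr 2
    omega
  have hhigh (a : ℕ) : coeff (r + a) (mk ω * elemNeg v)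
      = ∑ μ ∈ Finset.range (r + 1), signedEsymm v μ * ω (μ + a) := by
    rw [mul_comm, coeff_mul, Finset.Nat.sum_antidiagonal_eq_sum_range_succ_mk,
      ← Finset.sum_range_reflect (n := r + 1)]
    rw [← Finset.sum_subset (s₁ := Finset.range (r + 1)) (by
      intro i hi; simp at hi ⊢; omega)]
    · refine Finset.sum_congr rfl fun k hk => ?_
      have := Finset.mem_range.1 hk
      rw [coeff_mk, coeff_elemNeg_of_le v (by omega)]
      congr 2
      omega
    · intro i _ hi
      rw [coeff_elemNeg_of_lt v (by simpa using hi), zero_mul]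
  have hodd (n : ℕ) (hn : n < r) : Odd (r - (r - 1 - n)) ↔ Even n := by
    rw [show r - (r - 1 - n) = n + 1 by omega, Nat.odd_add_one, Nat.not_odd_iff_even]
  have heven (n : ℕ) (hn : n < r) : Even (r - 1 - n) ↔ Odd (r + n) := by
    simp only [Nat.even_iff, Nat.odd_iff]
    omega
  have hlow' (n : ℕ) (hn : n < r) :
      -2 * (if Even n then 1 else 0) * coeff (n + 1) (elemNeg v)
        + (if Odd (r + n) then 1 else 0) * coeff n (elemNeg v)
      = -2 * (if Odd (r - (r - 1 - n)) then 1 else 0) * signedEsymm v (r - 1 - n)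
        + (if Even (r - 1 - n) then 1 else 0) * signedEsymm v (r - 1 - n + 1) := by
    rw [coeff_elemNeg_of_le v hn, coeff_elemNeg_of_le v hn.le, if_congr (hodd n hn) rfl rfl,
      if_congr (heven n hn) rfl rfl, show r - (n + 1) = r - 1 - n by omega,
      show r - n = r - 1 - n + 1 by omega]
  have hhigh' (a : ℕ) : -2 * (if Even (r + a) then 1 else 0) * coeff (r + a + 1) (elemNeg v)
      + (if Odd (r + (r + a)) then 1 else 0) * coeff (r + a) (elemNeg v) = 0 := by
    rw [coeff_elemNeg_of_lt v (by omega)]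
    -- At a = 0 the coefficient of degree r need not vanish, but r + r is even and the parity factor
    -- removes it.
    rcases Nat.eq_zero_or_pos a with rfl | ha
    · rw [if_neg (by simp [← two_mul] : ¬ Odd (r + (r + 0)))]; simp
    · rw [coeff_elemNeg_of_lt v (by omega)]; simp
  constructor
  · rintro ⟨h1, h2⟩ n
    rcases Nat.lt_or_ge n r with hn | hn
    · rw [hlow n hn, hlow' n hn]
      exact h1 _ (by omega)
    · obtain ⟨a, rfl⟩ := Nat.exists_eq_add_of_le hn
      rw [hhigh, hhigh', h2]
  · intro h
    refine ⟨fun j hj => ?_, fun a => ?_⟩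
    · have := h (r - 1 - j)
      rwa [hlow _ (by omega), hlow' _ (by omega),
        show r - 1 - (r - 1 - j) = j by omega] at this
    · rw [← hhigh, h, hhigh']

/-- Admissibility prescribes the product of the series of ω with `elemNeg v`, which has constant
term 1 and can be cancelled. -/
theorem Admissible.unique {ω ω' : ℕ → R} {v : Fin r → R} (h : Admissible ω v)
    (h' : Admissible ω' v) : ω = ω' := by
  rw [admissible_iff_coeff] at h h'
  have hmul : mk ω * elemNeg v = mk ω' * elemNeg v := by
    ext n; rw [h, h']
  have hu : elemNeg v * invOfUnit (elemNeg v) 1 = 1 :=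
    mul_invOfUnit _ _ (constantCoeff_elemNeg v)
  have : mk ω = mk ω' := by
    simpa [mul_assoc, hu] using congrArg (· * invOfUnit (elemNeg v) 1) hmul
  ext n
  simpa using congrArg (coeff n) this

theorem exists_admissible (v : Fin r → R) : ∃ ω : ℕ → R, Admissible ω v := by
  let N : R⟦X⟧ := mk fun n => -2 * (if Even n then 1 else 0) * coeff (n + 1) (elemNeg v)
        + (if Odd (r + n) then 1 else 0) * coeff n (elemNeg v)
  refine ⟨fun n => coeff n (N * invOfUnit (elemNeg v) 1), ?_⟩
  rw [admissible_iff_coeff]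
  intro n
  have : mk (fun n => coeff n (N * invOfUnit (elemNeg v) 1)) = N * invOfUnit (elemNeg v) 1 := by
    ext; simp
  rw [this, mul_assoc, invOfUnit_mul _ _ (constantCoeff_elemNeg v), mul_one, coeff_mk]

theorem Admissible.map {S : Type*} [CommRing S] (φ : R →+* S) {ω : ℕ → R} {v : Fin r → R}
    (h : Admissible ω v) : Admissible (fun a => φ (ω a)) (fun i => φ (v i)) := by
  have hE (n : ℕ) : coeff n (elemNeg fun i => φ (v i)) = φ (coeff n (elemNeg v)) := by
    rw [← coeff_map]
    simp [elemNeg, map_prod]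
  rw [admissible_iff_coeff] at h ⊢
  intro n
  have hw : coeff n (mk (fun a => φ (ω a)) * elemNeg fun i => φ (v i))
      = φ (coeff n (mk ω * elemNeg v)) := by
    simp [coeff_mul, hE]
  rw [hw, h, hE, hE]
  have h2 : φ 2 = 2 := map_ofNat φ 2
  split_ifs <;> simp [h2]

/-- The generating function of the Schur `q`-functions. -/
noncomputable def qSeries (v : Fin r → R) : R⟦X⟧ :=
  mk fun a => MvPolynomial.aeval v (schurQ r a)

theorem qSeries_mul (v : Fin r → R) : qSeries v * elemNeg v = elemPos v := by
  let φ : MvPolynomial (Fin r) ℤ →+* R := (MvPolynomial.aeval v).toRingHom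
  let P : (MvPolynomial (Fin r) ℤ)⟦X⟧ := ∏ i : Fin r,
      ((1 + C (MvPolynomial.X i : MvPolynomial (Fin r) ℤ) * X) *
        invOfUnit (1 - C (MvPolynomial.X i : MvPolynomial (Fin r) ℤ) * X) 1)
  have hq : qSeries v = PowerSeries.map φ P := by
    ext a
    rw [qSeries, coeff_mk, coeff_map]
    rfl
  have hP : P * elemNeg (fun i => (MvPolynomial.X i : MvPolynomial (Fin r) ℤ))
      = elemPos (fun i => (MvPolynomial.X i : MvPolynomial (Fin r) ℤ)) := by
    rw [elemNeg, elemPos, ← Finset.prod_mul_distrib]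
    refine Finset.prod_congr rfl fun i _ => ?_
    rw [mul_assoc, invOfUnit_mul _ _ (by simp), mul_one]
  have := congrArg (PowerSeries.map φ) hP
  rw [map_mul, ← hq] at this
  simpa [elemNeg, elemPos, map_prod, φ] using this

/-- In generating functions, u-admissibility expresses the series of ω through `qSeries v`.
Multiplying by the unit `elemNeg v` turns `qSeries v` into `elemPos v`, whose coefficients differ
from those of `elemNeg v` by signs only; the sums 1 ± 1 then become the parity indicators. -/
theorem uAdmissible_iff_admissible [Invertible (2 : R)] (hr : 1 ≤ r) (ω : ℕ → R)
    (v : Fin r → R) : UAdmissible ω v ↔ Admissible ω v := by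
  have hu : elemNeg v * invOfUnit (elemNeg v) 1 = 1 :=
    mul_invOfUnit _ _ (constantCoeff_elemNeg v)
  have hq := qSeries_mul v
  have hq0 : constantCoeff (qSeries v) = 1 := by
    have h1 : constantCoeff (elemPos v) = 1 := by simp [elemPos, map_prod]
    have := congrArg constantCoeff hq
    rwa [map_mul, constantCoeff_elemNeg, mul_one, h1] at this
  let c : R⟦X⟧ := C (⅟(2 : R))
  have step1 : UAdmissible ω v ↔ X * mk ω
      = qSeries v - 1 + X * (C ((-1) ^ (r - 1)) * c * qSeries v + c) := by
    constructor
    · intro h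
      ext n
      rcases n with _ | n
      · simp [hq0]
      · rw [coeff_succ_X_mul, map_add, coeff_succ_X_mul, coeff_mk, h n]
        simp only [c, ← map_mul, map_sub, map_add, coeff_C_mul, coeff_one, coeff_C, qSeries,
          coeff_mk]
        simp
        ring
    · intro h n
      have := congrArg (coeff (n + 1)) h
      rw [coeff_succ_X_mul, map_add, coeff_succ_X_mul, coeff_mk] at this
      rw [this]
      simp only [c, ← map_mul, map_sub, map_add, coeff_C_mul, coeff_one, coeff_C, qSeries,
          coeff_mk]
      simp
      ring
  have step2 : X * mk ω = qSeries v - 1 + X * (C ((-1) ^ (r - 1)) * c * qSeries v + c) ↔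
      X * (mk ω * elemNeg v) = elemPos v - elemNeg v
        + X * (C ((-1) ^ (r - 1)) * c * elemPos v + c * elemNeg v) := by
    constructor
    · intro h
      rw [← mul_assoc, h, ← hq]
      ring
    · intro h
      have h' := congrArg (· * invOfUnit (elemNeg v) 1) h
      simp only [← hq] at h'
      linear_combination h' + (qSeries v - 1 + X * (C ((-1) ^ (r - 1)) * c * qSeries v + c)
        - X * mk ω) * hu
  rw [step1, step2, admissible_iff_coeff]
  have hco (n : ℕ) : coeff (n + 1) (elemPos v - elemNeg v
        + X * (C ((-1) ^ (r - 1)) * c * elemPos v + c * elemNeg v))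
      = -2 * (if Even n then 1 else 0) * coeff (n + 1) (elemNeg v)
        + (if Odd (r + n) then 1 else 0) * coeff n (elemNeg v) := by
    obtain ⟨k, rfl⟩ := Nat.exists_eq_add_of_le' hr
    have h2 : ⅟(2 : R) * 2 = 1 := invOf_mul_self 2
    rw [map_add, coeff_succ_X_mul]
    simp only [c, ← map_mul, map_sub, map_add, coeff_C_mul, coeff_elemPos, Nat.add_sub_cancel]
    have ho : Odd (k + 1 + n) ↔ (Even n ↔ Even k) := by
      simp only [Nat.even_iff, Nat.odd_iff]
      omega
    rcases Nat.even_or_odd n with hn | hn <;> rcases Nat.even_or_odd k with hk | hk <;>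
      simp [ho, pow_succ, hn.neg_one_pow, hk.neg_one_pow, hn, hk, Nat.not_even_iff_odd.2] <;>
      first
      | linear_combination (coeff n (elemNeg v)) * h2
      | ring
  constructor
  · intro h n
    rw [← hco, ← h, coeff_succ_X_mul]
  · intro h
    ext n
    rcases n with _ | n
    · have := coeff_elemPos v 0
      simp_all
    · rw [hco, coeff_succ_X_mul, h]

end GeneratingFunctions

/-! ### Interpolation at distinct parameters. -/

section Vandermonde

variable {K : Type*} [Field K] {r : ℕ} {u : Fin r → K}

theorem eq_zero_of_sum_mul_pow (hu : Function.Injective u) {c : Fin r → K}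
    (h : ∀ j, ∑ b, c b * u j ^ (b : ℕ) = 0) : c = 0 :=
  Matrix.eq_zero_of_forall_index_sum_mul_pow_eq_zero hu h

theorem eq_zero_of_sum_mul_pow_mul_pow (hu : Function.Injective u) {c : Fin r → Fin r → K}
    (h : ∀ i j, ∑ a, ∑ b, c a b * u i ^ (a : ℕ) * u j ^ (b : ℕ) = 0) : c = 0 := by
  have h1 (i : Fin r) : (fun b => ∑ a, c a b * u i ^ (a : ℕ)) = 0 := by
    refine eq_zero_of_sum_mul_pow hu fun j => ?_
    simp only [Finset.sum_mul]
    rw [Finset.sum_comm]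
    exact h i j
  ext a b
  exact congrFun (eq_zero_of_sum_mul_pow (c := fun a => c a b) hu fun i => congrFun (h1 i) b) a

/-- A functional on `K[x]/p` is determined by weights at the distinct roots of `p`. -/
theorem Admissible.exists_weights {ω : ℕ → K} (h : Admissible ω u) (hu : Function.Injective u) :
    ∃ γ : Fin r → K, ∀ a, ω a = ∑ i, γ i * u i ^ a := by
  have hdet : IsUnit (Matrix.vandermonde u).transpose := by
    rw [Matrix.isUnit_iff_isUnit_det, Matrix.det_transpose, isUnit_iff_ne_zero]
    exact Matrix.det_vandermonde_ne_zero_iff.2 hu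
  -- The weights are fitted to ω_0, …, ω_{r-1}. The second admissibility condition is a recurrence
  -- with characteristic polynomial p, which the power sums also satisfy, so the fit persists.
  obtain ⟨γ, hγ⟩ := (Matrix.mulVec_surjective_iff_isUnit.2 hdet) (fun a : Fin r => ω a)
  refine ⟨γ, fun a => ?_⟩
  induction a using Nat.strong_induction_on with
  | _ a ih =>
    rcases Nat.lt_or_ge a r with ha | ha
    · have := congrFun hγ ⟨a, ha⟩
      simp only [Matrix.mulVec, dotProduct, Matrix.transpose_apply, Matrix.vandermonde_apply] at this
      rw [← this]
      exact Finset.sum_congr rfl fun i _ => mul_comm _ _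
    · obtain ⟨k, rfl⟩ := Nat.exists_eq_add_of_le ha
      have h1 := h.2 k
      have h2 (i : Fin r) : ∑ μ ∈ Finset.range (r + 1), signedEsymm u μ * u i ^ (μ + k) = 0 := by
        have h3 : Polynomial.aeval (u i) (cycPoly u) = 0 := by
          simp [cycPoly, Finset.prod_eq_zero_iff, sub_eq_zero]
        rw [aeval_cycPoly] at h3
        have h4 := congrArg (· * u i ^ k) h3
        simp only [Finset.sum_mul, zero_mul] at h4
        rw [← h4]
        refine Finset.sum_congr rfl fun μ hμ => ?_
        rw [signedEsymm_eq_coeff u (Nat.lt_succ_iff.1 (Finset.mem_range.1 hμ)), smul_eq_mul,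
          pow_add, mul_assoc]
      have h5 : ∑ μ ∈ Finset.range (r + 1), signedEsymm u μ *
          (ω (μ + k) - ∑ i, γ i * u i ^ (μ + k)) = 0 := by
        simp only [mul_sub, Finset.sum_sub_distrib, h1, Finset.mul_sum]
        rw [Finset.sum_comm, zero_sub, neg_eq_zero]
        refine Finset.sum_eq_zero fun i _ => ?_
        have := congrArg (γ i * ·) (h2 i)
        simp only [Finset.mul_sum, mul_zero] at this
        rw [← this]
        exact Finset.sum_congr rfl fun μ _ => by ring
      rw [Finset.sum_range_succ, Finset.sum_eq_zero, zero_add, signedEsymm_eq_coeff u le_rfl,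
        cycPoly_coeff_top, one_mul, sub_eq_zero] at h5
      · exact h5
      · intro μ hμ
        rw [← ih (μ + k) (by have := Finset.mem_range.1 hμ; omega), sub_self, mul_zero]

end Vandermonde

/-! ### Identities for the weights of ω at the roots. -/

section PartialFractions

variable {K : Type*} [Field K] {r : ℕ} {u : Fin r → K}

/-- The divided difference of `∏ (X - u_i)` at `t`, `z`. -/
noncomputable def divDiff (u : Fin r → K) (t z : K) : K :=
  ∑ j ∈ Finset.range r, t ^ j * ∑ μ ∈ Finset.range (r - j), z ^ μ * (cycPoly u).coeff (μ + j + 1)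

theorem eval_cycPoly_eq_sum (t : K) : (cycPoly u).eval t
    = ∑ n ∈ Finset.range (r + 1), (cycPoly u).coeff n * t ^ n :=
  Polynomial.eval_eq_sum_range' (Nat.lt_succ_of_le (cycPoly_natDegree_le u)) t

theorem eval_cycPoly (t : K) : (cycPoly u).eval t = ∏ i, (t - u i) := by
  simp [cycPoly, Polynomial.eval_prod]

theorem eval_cycPoly_root (i : Fin r) : (cycPoly u).eval (u i) = 0 := by
  rw [eval_cycPoly]
  exact Finset.prod_eq_zero (Finset.mem_univ i) (sub_self _)

theorem sub_mul_divDiff (t z : K) :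
    (t - z) * divDiff u t z = (cycPoly u).eval t - (cycPoly u).eval z := by
  have h : divDiff u t z = ∑ n ∈ Finset.range (r + 1), (cycPoly u).coeff n *
      ∑ i ∈ Finset.range n, t ^ i * z ^ (n - 1 - i) := by
    simp only [divDiff, Finset.mul_sum]
    rw [Finset.sum_sigma', Finset.sum_sigma']
    refine Finset.sum_bij' (fun p _ => ⟨p.2 + p.1 + 1, p.1⟩)
      (fun p _ => ⟨p.2, p.1 - 1 - p.2⟩) ?_ ?_ ?_ ?_ ?_
    · rintro ⟨n, i⟩ hn; simp at hn ⊢; omega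
    · rintro ⟨n, i⟩ hn; simp at hn ⊢; omega
    · rintro ⟨n, i⟩ hn
      simp only [Finset.mem_sigma, Finset.mem_range] at hn
      simp only [Sigma.mk.injEq, heq_eq_eq, true_and]
      omega
    · rintro ⟨n, i⟩ hn
      simp only [Finset.mem_sigma, Finset.mem_range] at hn
      simp only [Sigma.mk.injEq, heq_eq_eq, and_true]
      omega
    · rintro ⟨n, i⟩ hn
      simp only [Finset.mem_sigma, Finset.mem_range] at hn
      rw [show i + n + 1 - 1 - n = i by omega]
      ring
  rw [h, eval_cycPoly_eq_sum, eval_cycPoly_eq_sum, ← Finset.sum_sub_distrib, Finset.mul_sum]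
  refine Finset.sum_congr rfl fun n _ => ?_
  rw [← mul_sub, ← (Commute.all t z).mul_geom_sum₂ n]
  ring

/-- The first admissibility conditions, multiplied by t^j and summed. Parity indicators become
combinations of p(t) and p(-t); the factor 2t avoids a division. -/
theorem Admissible.sum_divDiff {ω : ℕ → K} (h : Admissible ω u) {γ : Fin r → K}
    (hγ : ∀ a, ω a = ∑ i, γ i * u i ^ a) (t : K) :
    2 * t * ∑ i, γ i * divDiff u t (u i)
      = -(2 * t) * ((cycPoly u).eval t - (-1) ^ r * (cycPoly u).eval (-t))
        + ((cycPoly u).eval t - (cycPoly u).eval (-t)) := by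
  have h1 : ∑ i, γ i * divDiff u t (u i) = ∑ j ∈ Finset.range r, t ^ j *
      (-2 * (if Odd (r - j) then 1 else 0) * (cycPoly u).coeff j
        + (if Even j then 1 else 0) * (cycPoly u).coeff (j + 1)) := by
    simp only [divDiff, Finset.mul_sum]
    rw [Finset.sum_comm]
    refine Finset.sum_congr rfl fun j hj => ?_
    have hj' := Finset.mem_range.1 hj
    have := h.1 j hj'
    rw [signedEsymm_eq_coeff u hj'.le, signedEsymm_eq_coeff u hj'] at this
    rw [← this, Finset.sum_comm, Finset.mul_sum]
    refine Finset.sum_congr rfl fun μ hμ => ?_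
    rw [signedEsymm_eq_coeff u (by have := Finset.mem_range.1 hμ; omega), hγ, Finset.sum_mul,
      Finset.mul_sum]
    exact Finset.sum_congr rfl fun i _ => by ring
  have h2 : (cycPoly u).eval t - (-1) ^ r * (cycPoly u).eval (-t) = ∑ j ∈ Finset.range r,
      2 * (if Odd (r - j) then 1 else 0) * (cycPoly u).coeff j * t ^ j := by
    have h3 : (-1 : K) ^ r * ((cycPoly u).coeff r * (-t) ^ r) = (cycPoly u).coeff r * t ^ r := by
      rw [neg_pow t]
      have : (-1 : K) ^ r * (-1) ^ r = 1 := by rw [← mul_pow]; simp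
      linear_combination ((cycPoly u).coeff r * t ^ r) * this
    rw [eval_cycPoly_eq_sum, eval_cycPoly_eq_sum, Finset.sum_range_succ, Finset.sum_range_succ,
      mul_add, h3, add_sub_add_right_eq_sub, Finset.mul_sum, ← Finset.sum_sub_distrib]
    refine Finset.sum_congr rfl fun j hj => ?_
    obtain ⟨k, rfl⟩ := Nat.exists_eq_add_of_le (Finset.mem_range.1 hj).le
    have h4 : (-1 : K) ^ j * (-1) ^ j = 1 := by rw [← mul_pow]; simp
    rw [Nat.add_sub_cancel_left, neg_pow t, pow_add]
    rcases Nat.even_or_odd k with hk | hk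
    · simp only [hk.neg_one_pow, Nat.not_odd_iff_even.2 hk, if_false]
      linear_combination (-(cycPoly u).coeff j * t ^ j) * h4
    · simp only [hk.neg_one_pow, hk, if_true]
      linear_combination ((cycPoly u).coeff j * t ^ j) * h4
  have h5 : (cycPoly u).eval t - (cycPoly u).eval (-t) = ∑ j ∈ Finset.range r,
      2 * t * (t ^ j * ((if Even j then 1 else 0) * (cycPoly u).coeff (j + 1))) := by
    rw [eval_cycPoly_eq_sum, eval_cycPoly_eq_sum, Finset.sum_range_succ', Finset.sum_range_succ',
      pow_zero, pow_zero, add_sub_add_right_eq_sub, ← Finset.sum_sub_distrib]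
    refine Finset.sum_congr rfl fun j _ => ?_
    rw [neg_pow t, pow_succ (-1 : K)]
    rcases Nat.even_or_odd j with hj | hj
    · simp only [hj.neg_one_pow, hj, if_true]
      ring
    · simp only [hj.neg_one_pow, Nat.not_even_iff_odd.2 hj, if_false]
      ring
  rw [h1, h2, h5, Finset.mul_sum, Finset.mul_sum, ← Finset.sum_add_distrib]
  exact Finset.sum_congr rfl fun j _ => by ring

/-- Parameters in general position. -/
structure Generic (u : Fin r → K) : Prop where
  inj : Function.Injective u
  add_ne (i j) : u i + u j ≠ 0
  add_one_ne (i j) : u i + 1 ≠ u j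
  two_ne : (2 : K) ≠ 0
  weight_ne (i) : (-1) ^ r * (2 * u i) ≠ 1

theorem Generic.eval_neg_ne (hu : Generic u) (i : Fin r) : (cycPoly u).eval (-u i) ≠ 0 := by
  rw [eval_cycPoly, Finset.prod_ne_zero_iff]
  intro j _ h
  exact hu.add_ne i j (by linear_combination -h)

/-- Evaluation of `Admissible.sum_divDiff` at t = -u_i, divided by p(-u_i) ≠ 0. This is what makes s
e = e hold in `rels_ideal`. -/
theorem Generic.sum_weights (hu : Generic u) {ω : ℕ → K} (h : Admissible ω u) {γ : Fin r → K}
    (hγ : ∀ a, ω a = ∑ i, γ i * u i ^ a) (i : Fin r) :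
    ∑ j, γ j / (u i + u j) = 1 + 1 / (u i + u i) := by
  have h1 := h.sum_divDiff hγ (-u i)
  rw [neg_neg, eval_cycPoly_root] at h1
  have h2 : ∑ j, γ j * divDiff u (-u i) (u j)
      = -(cycPoly u).eval (-u i) * ∑ j, γ j / (u i + u j) := by
    rw [Finset.mul_sum]
    refine Finset.sum_congr rfl fun j _ => ?_
    have h3 := sub_mul_divDiff (u := u) (-u i) (u j)
    rw [eval_cycPoly_root] at h3
    have := hu.add_ne i j
    field_simp
    linear_combination -γ j * h3
  rw [h2] at h1
  have h4 := hu.eval_neg_ne i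
  have h5 := hu.add_ne i i
  have h6 : (cycPoly u).eval (-u i) * ((u i + u i) * ∑ j, γ j / (u i + u j)
      - (u i + u i + 1)) = 0 := by linear_combination h1
  have h7 := (mul_eq_zero.1 h6).resolve_left h4
  refine mul_left_cancel₀ h5 ?_
  rw [mul_add, mul_one, mul_one_div_cancel h5]
  linear_combination h7

/-- At t = u_i the divided differences with the other roots vanish, so γ_i = 0 would force
p(-u_i)((-1)^r 2u_i - 1) = 0. -/
theorem Generic.weights_ne (hu : Generic u) {ω : ℕ → K} (h : Admissible ω u) {γ : Fin r → K}
    (hγ : ∀ a, ω a = ∑ i, γ i * u i ^ a) (i : Fin r) : γ i ≠ 0 := by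
  intro h0
  have h1 := h.sum_divDiff hγ (u i)
  rw [Finset.sum_eq_zero, eval_cycPoly_root] at h1
  · have h2 : (cycPoly u).eval (-u i) * ((-1) ^ r * (2 * u i) - 1) = 0 := by
      linear_combination -h1
    exact (mul_eq_zero.1 h2).elim (hu.eval_neg_ne i) (fun h => hu.weight_ne i (sub_eq_zero.1 h))
  · intro j _
    rcases eq_or_ne i j with rfl | hij
    · rw [h0, zero_mul]
    · have h3 := sub_mul_divDiff (u := u) (u i) (u j)
      rw [eval_cycPoly_root, eval_cycPoly_root, sub_zero] at h3
      rw [(mul_eq_zero.1 h3).resolve_left (sub_ne_zero.2 (hu.inj.ne hij)), mul_zero]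

end PartialFractions

/-! ### Explicit representations over a field. -/

section Representations

open Matrix

variable {K : Type*} [Field K] {r : ℕ} {u : Fin r → K} {ω : ℕ → K}

theorem aeval_cycPoly_diagonal {n : Type*} [Fintype n] [DecidableEq n] {d : n → K}
    (hd : ∀ k, ∃ i, d k = u i) :
    Polynomial.aeval (diagonal d) (cycPoly u) = 0 := by
  have h : (diagonal d : Matrix n n K) = diagonalAlgHom K d := rfl
  have h2 : Polynomial.aeval d (cycPoly u) = 0 := by
    funext k
    obtain ⟨i, hi⟩ := hd k
    rw [Polynomial.aeval_fn_apply, hi]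
    exact eval_cycPoly_root i
  rw [h, Polynomial.aeval_algHom_apply, h2, map_zero]

/-- With e = 0 and scalars, the skein relation reads σ(x - y) = -1, which forces y = x + σ. -/
theorem rels_one (i : Fin r) {σ : K} (hσ : σ * σ = 1) : Rels ω u σ 0 (u i) (u i + σ) where
  s_sq := hσ
  x_comm := mul_comm _ _
  skein_left := by linear_combination -hσ
  skein_right := by linear_combination -hσ
  unwrap := by simp
  e_s := zero_mul _
  s_e := mul_zero _
  antisymm_left := zero_mul _
  antisymm_right := mul_zero _
  cyc := eval_cycPoly_root i

/-- The skein relation fixes the diagonal of s. The upper off-diagonal entry is normalized to 1, so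
it is nonzero even when α² = 1. -/
theorem rels_two {i j : Fin r} {α : K} (hα : α * (u j - u i) = 1) :
    Rels ω u (!![α, 1; 1 - α ^ 2, -α] : Matrix _ _ K) 0
      (diagonal ![u i, u j]) (diagonal ![u j, u i]) where
  s_sq := by
    ext a b; fin_cases a <;> fin_cases b <;> simp [Matrix.mul_apply, Fin.sum_univ_two] <;> ring
  x_comm := by simp [diagonal_mul_diagonal, mul_comm]
  skein_left := by
    ext a b
    rw [Matrix.sub_apply, mul_diagonal, diagonal_mul]
    fin_cases a <;> fin_cases b <;> simp <;> first | linear_combination -hα | ring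
  skein_right := by
    ext a b
    rw [Matrix.sub_apply, mul_diagonal, diagonal_mul]
    fin_cases a <;> fin_cases b <;> simp <;> first | linear_combination -hα | ring
  unwrap := by simp
  e_s := zero_mul _
  s_e := mul_zero _
  antisymm_left := zero_mul _
  antisymm_right := mul_zero _
  cyc := aeval_cycPoly_diagonal (by intro k; fin_cases k <;> simp)

/-- A model of the span of the x^k e, in the eigenbasis of x. Since y = -x, the skein relation
forces (u_i + u_j) s_ij = γ_j - δ_ij. -/
theorem rels_ideal (hu : Generic u) (h : Admissible ω u) {γ : Fin r → K}
    (hγ : ∀ a, ω a = ∑ i, γ i * u i ^ a) :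
    Rels ω u (of fun i j => (γ j - if i = j then 1 else 0) / (u i + u j) : Matrix _ _ K)
      (of fun _ j => γ j) (diagonal u) (-diagonal u) := by
  set s : Matrix (Fin r) (Fin r) K :=
    of fun i j => (γ j - if i = j then 1 else 0) / (u i + u j) with hs
  set e : Matrix (Fin r) (Fin r) K := of fun _ j => γ j with he
  set x : Matrix (Fin r) (Fin r) K := diagonal u with hx
  have hsum := hu.sum_weights h hγ
  have skein_left : s * x - -x * s = e - 1 := by
    ext i j
    have := hu.add_ne i j
    simp [hs, hx, he, Matrix.one_apply]
    field_simp
    ring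
  have skein_right : x * s - s * -x = e - 1 := by
    ext i j
    have := hu.add_ne i j
    simp [hs, hx, he, Matrix.one_apply]
    field_simp
  have s_e : s * e = e := by
    ext i k
    have h1 : ∑ j, (γ j - if i = j then 1 else 0) / (u i + u j) = 1 := by
      simp only [sub_div, Finset.sum_sub_distrib, hsum, ite_div, zero_div]
      simp
    simp [Matrix.mul_apply, hs, he, ← Finset.sum_mul, h1]
  have e_s : e * s = e := by
    ext i k
    have h1 : ∑ j, γ j * ((γ k - if j = k then 1 else 0) / (u j + u k))
        = γ k * ∑ j, γ j / (u k + u j) - γ k / (u k + u k) := by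
      simp only [sub_div, mul_sub, Finset.sum_sub_distrib, ite_div, zero_div, Finset.mul_sum]
      congr 1
      · exact Finset.sum_congr rfl fun j _ => by rw [add_comm]; ring
      · simp [div_eq_mul_inv]
    simp only [Matrix.mul_apply, hs, he, of_apply, h1, hsum]
    ring
  -- Rather than squaring s entrywise: s² commutes with x, which has distinct eigenvalues, so s² is
  -- diagonal; it fixes e, whose diagonal entries γ_i are nonzero, so s² = 1.
  have comm : s * s * x = x * (s * s) := by
    have h1 : s * x = -x * s + e - 1 := by rw [add_sub_assoc, ← skein_left]; abel
    have h2 : s * -x = x * s - e + 1 := by rw [sub_add, ← skein_right]; abel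
    calc s * s * x = s * (-x * s + e - 1) := by rw [mul_assoc, h1]
      _ = (s * -x) * s + e - s := by rw [mul_sub, mul_add, s_e, mul_one, mul_assoc]
      _ = x * (s * s) := by rw [h2, add_mul, sub_mul, e_s, one_mul, mul_assoc]; abel
  have fix : s * s * e = e := by rw [mul_assoc, s_e, s_e]
  have off (i j) (hij : i ≠ j) : (s * s) i j = 0 := by
    have := congrFun (congrFun comm i) j
    rw [hx, mul_diagonal, diagonal_mul] at this
    have h1 : (u j - u i) * (s * s) i j = 0 := by linear_combination this
    exact (mul_eq_zero.1 h1).resolve_left (sub_ne_zero.2 (hu.inj.ne hij.symm))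
  have s_sq : s * s = 1 := by
    ext i j
    rcases eq_or_ne i j with rfl | hij
    · have h1 := congrFun (congrFun fix i) i
      rw [Matrix.mul_apply, Finset.sum_eq_single i (fun k _ hk => by rw [off i k hk.symm, zero_mul])
        (by simp)] at h1
      rw [Matrix.one_apply_eq]
      exact mul_right_cancel₀ (hu.weights_ne h hγ i) (h1.trans (one_mul _).symm)
    · rw [off i j hij, Matrix.one_apply_ne hij]
  refine ⟨s_sq, by simp, skein_left, skein_right, fun a => ?_, e_s, s_e, by simp, by simp,
    aeval_cycPoly_diagonal fun k => ⟨k, rfl⟩⟩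
  ext i j
  rw [hx, diagonal_pow, Matrix.mul_apply]
  simp [he, hγ, Finset.sum_mul]

end Representations

/-! ### Linear independence for generic parameters. -/

section Independence

variable {K : Type*} [Field K] {r : ℕ} {u : Fin r → K} {ω : ℕ → K}

theorem Generic.linearIndependent (hu : Generic u) (h : Admissible ω u) :
    LinearIndependent K (algebraFamily ω u) := by
  rw [Fintype.linearIndependent_iff]
  intro c hc
  simp only [Fintype.sum_sum_type, algebraFamily, Fintype.sum_prod_type] at hc
  have key {B : Type _} [Ring B] [Algebra K B] {s e x y : B} (hB : Rels ω u s e x y) :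
      ∑ a : Fin r, ∑ b : Fin r, c (Sum.inl (a, b)) • (x ^ (a : ℕ) * e * x ^ (b : ℕ))
      + (∑ a : Fin r, ∑ b : Fin r, c (Sum.inr (Sum.inl (a, b))) • (x ^ (a : ℕ) * y ^ (b : ℕ) * s)
        + ∑ a : Fin r, ∑ b : Fin r, c (Sum.inr (Sum.inr (a, b))) • (x ^ (a : ℕ) * y ^ (b : ℕ)))
      = 0 := by
    obtain ⟨f, rfl, rfl, rfl, rfl⟩ := hB.exists_lift
    simpa using congrArg f hc
  -- G and F hold the coefficients of x^a y^b s and x^a y^b, viewed as polynomials in two variables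
  -- of degree below r in each.
  let G : Fin r → Fin r → K := fun a b => c (Sum.inr (Sum.inl (a, b)))
  let F : Fin r → Fin r → K := fun a b => c (Sum.inr (Sum.inr (a, b)))
  let ev (H : Fin r → Fin r → K) (s t : K) : K :=
    ∑ a, ∑ b, H a b * (s ^ (a : ℕ) * t ^ (b : ℕ))
  have hone (i : Fin r) (σ : K) (hσ : σ * σ = 1) :
      σ * ev G (u i) (u i + σ) + ev F (u i) (u i + σ) = 0 := by
    rw [← key (rels_one (ω := ω) i hσ)]
    simp only [ev, Finset.mul_sum, F, G, mul_zero, zero_mul, Finset.sum_const_zero,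
      zero_add, smul_eq_mul]
    congr 1
    exact Finset.sum_congr rfl fun a _ => Finset.sum_congr rfl fun b _ => by ring
  have htwo (i j : Fin r) (hij : j ≠ i) : ev G (u i) (u j) = 0 ∧ ev F (u i) (u j) = 0 := by
    have hne := sub_ne_zero.2 (hu.inj.ne hij)
    have hk := key (rels_two (ω := ω) (inv_mul_cancel₀ hne))
    simp only [mul_zero, zero_mul, smul_zero, Finset.sum_const_zero, zero_add,
      Matrix.diagonal_pow, Matrix.diagonal_mul_diagonal] at hk
    -- F and x, y are diagonal here, so the (0,1) entry sees only G.
    have h01 := congrFun (congrFun hk 0) 1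
    have h00 := congrFun (congrFun hk 0) 0
    simp [Matrix.sum_apply] at h01 h00
    have hG : ev G (u i) (u j) = 0 := h01
    refine ⟨hG, ?_⟩
    have : ev G (u i) (u j) * (u j - u i)⁻¹ + ev F (u i) (u j) = 0 := by
      rw [← h00]
      simp [ev, F, G, Finset.sum_mul, mul_assoc]
    simpa [hG] using this
  -- The two-dimensional representations miss the point (u_i, u_i). The extra zero t, equal to u_i ±
  -- 1 below, replaces it: a polynomial of degree below r with r distinct zeros vanishes.
  have hrow (H : Fin r → Fin r → K) (i : Fin r) (t : K) (ht : ∀ j, t ≠ u j)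
      (h1 : ∀ j, j ≠ i → ev H (u i) (u j) = 0) (h2 : ev H (u i) t = 0) (j : Fin r) :
      ev H (u i) (u j) = 0 := by
    have hinj : Function.Injective (Function.update u i t) := by
      intro a b hab
      by_cases ha : a = i <;> by_cases hb : b = i
      · rw [ha, hb]
      · subst ha; simp [hb, ht] at hab
      · subst hb; simp [ha, (ht _).symm] at hab
      · simp only [Function.update_of_ne ha, Function.update_of_ne hb] at hab
        exact hu.inj hab
    have hswap (z : K) : ev H (u i) z = ∑ b : Fin r, (∑ a, H a b * u i ^ (a : ℕ)) * z ^ (b : ℕ) := by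
      simp only [ev, Finset.sum_mul]
      rw [Finset.sum_comm]
      simp only [mul_assoc]
    have := eq_zero_of_sum_mul_pow (c := fun b => ∑ a, H a b * u i ^ (a : ℕ)) hinj (fun k => by
      rw [← hswap]
      by_cases hk : k = i
      · subst hk; simpa using h2
      · simpa [hk] using h1 k hk)
    rw [hswap]
    exact Finset.sum_eq_zero fun b _ => by rw [congrFun this b, Pi.zero_apply, zero_mul]
  have hadd (s t : K) : ev (F + G) s t = ev F s t + ev G s t := by
    simp [ev, add_mul, Finset.sum_add_distrib]
  have hsub (s t : K) : ev (F - G) s t = ev F s t - ev G s t := by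
    simp [ev, sub_mul, Finset.sum_sub_distrib]
  have hplus (i j : Fin r) : ev (F + G) (u i) (u j) = 0 := by
    refine hrow _ i (u i + 1) (hu.add_one_ne i) (fun j hj => ?_) ?_ j
    · rw [hadd, (htwo i j hj).1, (htwo i j hj).2, add_zero]
    · rw [hadd]
      linear_combination hone i 1 (one_mul 1)
  have hminus (i j : Fin r) : ev (F - G) (u i) (u j) = 0 := by
    refine hrow _ i (u i + -1) (fun j hj => hu.add_one_ne j i (by rw [← hj]; ring))
      (fun j hj => ?_) ?_ j
    · rw [hsub, (htwo i j hj).1, (htwo i j hj).2, sub_zero]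
    · rw [hsub]
      linear_combination hone i (-1) (by ring)
  have hzero (H : Fin r → Fin r → K) (hH : ∀ i j, ev H (u i) (u j) = 0) : H = 0 :=
    eq_zero_of_sum_mul_pow_mul_pow hu.inj fun i j => by
      simpa only [ev, mul_assoc] using hH i j
  have hF : F = 0 := hzero F fun i j => by
    have h1 := hplus i j
    have h2 := hminus i j
    rw [hadd] at h1
    rw [hsub] at h2
    exact (mul_eq_zero.1 (by linear_combination h1 + h2 : 2 * ev F (u i) (u j) = 0)).resolve_left
      hu.two_ne
  have hG : G = 0 := hzero G fun i j => by
    have h1 := hplus i j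
    rw [hadd, hF] at h1
    simpa [ev] using h1
  have hF' (a b) : c (Sum.inr (Sum.inr (a, b))) = 0 := congrFun (congrFun hF a) b
  have hG' (a b) : c (Sum.inr (Sum.inl (a, b))) = 0 := congrFun (congrFun hG a) b
  obtain ⟨γ, hγ⟩ := h.exists_weights hu.inj
  have hL := key (rels_ideal hu h hγ)
  simp only [hF', hG', zero_smul, Finset.sum_const_zero, add_zero] at hL
  -- The (i, j) entry of x^a e x^b is γ_j u_i^a u_j^b, and γ_j can be cancelled.
  have hE : (fun a b => c (Sum.inl (a, b))) = (0 : Fin r → Fin r → K) :=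
    eq_zero_of_sum_mul_pow_mul_pow hu.inj fun i j => by
      have h1 := congrFun (congrFun hL i) j
      simp [Matrix.sum_apply, Matrix.diagonal_pow] at h1
      have h2 : γ j * ∑ a : Fin r, ∑ b : Fin r,
          c (Sum.inl (a, b)) * u i ^ (a : ℕ) * u j ^ (b : ℕ) = 0 := by
        rw [← h1, Finset.mul_sum]
        simp only [Finset.mul_sum]
        exact Finset.sum_congr rfl fun a _ => Finset.sum_congr rfl fun b _ => by ring
      exact (mul_eq_zero.1 h2).resolve_left (hu.weights_ne h hγ j)
  rintro (⟨a, b⟩ | ⟨a, b⟩ | ⟨a, b⟩)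
  · exact congrFun (congrFun hE a) b
  · exact hG' a b
  · exact hF' a b

end Independence

/-! ### Descent along injections and base change. -/

section Transfer

theorem aeval_cycPoly_algebraMap {S R : Type*} [CommRing S] [CommRing R] [Algebra S R] {r : ℕ}
    (v : Fin r → S) {B : Type*} [Ring B] [Algebra R B] [Algebra S B] [IsScalarTower S R B] (x : B) :
    Polynomial.aeval x (cycPoly fun i => algebraMap S R (v i))
      = Polynomial.aeval x (cycPoly v) := by
  rw [← Polynomial.aeval_map_algebraMap R x (cycPoly v)]
  simp [cycPoly, Polynomial.map_prod]

/-- The relations over a ring and over an extension of it agree. -/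
theorem rels_algebraMap_iff {S R : Type*} [CommRing S] [CommRing R] [Algebra S R] {ω : ℕ → S}
    {r : ℕ} {v : Fin r → S} {B : Type*} [Ring B] [Algebra R B] [Algebra S B] [IsScalarTower S R B]
    {s e x y : B} :
    Rels (fun a => algebraMap S R (ω a)) (fun i => algebraMap S R (v i)) s e x y
      ↔ Rels ω v s e x y := by
  constructor <;> rintro ⟨h1, h2, h3, h4, h5, h6, h7, h8, h9, h10⟩
  · exact ⟨h1, h2, h3, h4, fun a => by rw [h5, algebraMap_smul], h6, h7, h8, h9,
      by rwa [aeval_cycPoly_algebraMap] at h10⟩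
  · exact ⟨h1, h2, h3, h4, fun a => by rw [h5, algebraMap_smul], h6, h7, h8, h9,
      by rwa [aeval_cycPoly_algebraMap]⟩

theorem Rels.map {S : Type*} [CommRing S] {ω : ℕ → S} {r : ℕ} {v : Fin r → S}
    {A B : Type*} [Ring A] [Algebra S A] [Ring B] [Algebra S B] {s e x y : A}
    (h : Rels ω v s e x y) (f : A →ₐ[S] B) : Rels ω v (f s) (f e) (f x) (f y) where
  s_sq := by rw [← map_mul, h.s_sq, map_one]
  x_comm := by rw [← map_mul, h.x_comm, map_mul]
  skein_left := by simpa using congrArg f h.skein_left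
  skein_right := by simpa using congrArg f h.skein_right
  unwrap a := by simpa using congrArg f (h.unwrap a)
  e_s := by rw [← map_mul, h.e_s]
  s_e := by rw [← map_mul, h.s_e]
  antisymm_left := by simpa using congrArg f h.antisymm_left
  antisymm_right := by simpa using congrArg f h.antisymm_right
  cyc := by rw [Polynomial.aeval_algHom_apply, h.cyc, map_zero]

variable {S R : Type*} [CommRing S] [CommRing R] [Algebra S R] {ω : ℕ → S} {r : ℕ}
  {v : Fin r → S}

theorem linearIndependent_of_injective (hinj : Function.Injective (algebraMap S R))
    (h : LinearIndependent R (algebraFamily (fun a => algebraMap S R (ω a))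
      (fun i => algebraMap S R (v i)))) : LinearIndependent S (algebraFamily ω v) := by
  let ω' : ℕ → R := fun a => algebraMap S R (ω a)
  let v' : Fin r → R := fun i => algebraMap S R (v i)
  let : Algebra S (W₂ ω' v') := Algebra.compHom _ (algebraMap S R)
  have : IsScalarTower S R (W₂ ω' v') := IsScalarTower.of_algebraMap_eq fun _ => rfl
  obtain ⟨f, hs, he, hx, hy⟩ := (rels_algebraMap_iff.1 (W₂.rels ω' v')).exists_lift
  have h2 : LinearIndependent S (algebraFamily ω' v') :=
    h.restrict_scalars (by
      intro a b hab
      exact hinj (by simpa [Algebra.smul_def] using hab))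
  refine LinearIndependent.of_comp f.toLinearMap ?_
  convert h2 using 1
  funext i
  rcases i with ⟨a, b⟩ | ⟨a, b⟩ | ⟨a, b⟩ <;> simp [algebraFamily, hs, he, hx, hy]

/-- Independence alone need not survive a change of rings, but a basis does. The family spans, hence
is a basis, and R ⊗ W satisfies the relations over R; the induced map sends the family over R to the
extended basis. -/
theorem LinearIndependent.algebraFamily_map (h : LinearIndependent S (algebraFamily ω v)) :
    LinearIndependent R (algebraFamily (fun a => algebraMap S R (ω a))
      (fun i => algebraMap S R (v i))) := by
  let b := Module.Basis.mk h (span_algebraFamily ω v).ge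
  let B := TensorProduct S R (W₂ ω v)
  let ι : W₂ ω v →ₐ[S] B := Algebra.TensorProduct.includeRight
  obtain ⟨f, hs, he, hx, hy⟩ := (rels_algebraMap_iff (R := R).2 ((W₂.rels ω v).map ι)).exists_lift
  refine LinearIndependent.of_comp f.toLinearMap ?_
  have hb : f.toLinearMap ∘ algebraFamily (fun a => algebraMap S R (ω a))
      (fun i => algebraMap S R (v i)) = Algebra.TensorProduct.basis R b := by
    funext i
    have : Algebra.TensorProduct.basis R b i = ι (algebraFamily ω v i) := by
      rw [Algebra.TensorProduct.basis_apply, Module.Basis.mk_apply]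
      rfl
    rw [this]
    rcases i with ⟨a, b⟩ | ⟨a, b⟩ | ⟨a, b⟩ <;> simp [algebraFamily, hs, he, hx, hy]
  rw [hb]
  exact (Algebra.TensorProduct.basis R b).linearIndependent

end Transfer

/-! ### The universal case and its specialization. -/

section Universal

variable (r : ℕ)

theorem generic_X : Generic (fun i : Fin r => algebraMap (MvPolynomial (Fin r) ℤ)
    (FractionRing (MvPolynomial (Fin r) ℤ)) (MvPolynomial.X i)) := by
  let P := MvPolynomial (Fin r) ℤ
  -- Positive multiples of 3: sums are nonzero, differences are never 1, and twice a value is never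
  -- ±1.
  let φ : P →+* ℤ := MvPolynomial.eval fun i : Fin r => 3 * (i : ℤ) + 3
  have hφ (i : Fin r) : φ (MvPolynomial.X i) = 3 * (i : ℤ) + 3 := MvPolynomial.eval_X i
  have hinj : Function.Injective (algebraMap P (FractionRing P)) := IsFractionRing.injective _ _
  have key {p q : P} (h : algebraMap P (FractionRing P) p = algebraMap P (FractionRing P) q) :
      φ p = φ q := congrArg φ (hinj h)
  refine ⟨fun i j hij => MvPolynomial.X_injective (hinj hij), fun i j h => ?_, fun i j h => ?_,
    fun h => ?_, fun i h => ?_⟩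
  · have := key (p := MvPolynomial.X i + MvPolynomial.X j) (q := 0) (by simpa using h)
    rw [map_add, hφ, hφ, map_zero] at this
    omega
  · have := key (p := MvPolynomial.X i + 1) (q := MvPolynomial.X j) (by simpa using h)
    rw [map_add, hφ, hφ, map_one] at this
    omega
  · have := key (p := 1 + 1) (q := 0) (by
      rw [map_add, map_one, map_zero, one_add_one_eq_two]
      exact h)
    simp at this
  · have := key (p := (-1) ^ r * (MvPolynomial.X i + MvPolynomial.X i)) (q := 1) (by
      simp only [map_mul, map_pow, map_neg, map_one, map_add]
      linear_combination h)
    simp only [map_mul, hφ, map_pow, map_neg, map_one, map_add] at this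
    rcases Nat.even_or_odd r with hr | hr <;> rw [hr.neg_one_pow] at this <;> omega

theorem linearIndependent_of_admissible {R : Type*} [CommRing R] {ω : ℕ → R} {r : ℕ}
    {v : Fin r → R} (h : Admissible ω v) : LinearIndependent R (algebraFamily ω v) := by
  let P := MvPolynomial (Fin r) ℤ
  obtain ⟨ω₀, h₀⟩ := exists_admissible (fun i : Fin r => (MvPolynomial.X i : P))
  have hP : LinearIndependent P (algebraFamily ω₀ fun i => MvPolynomial.X i) :=
    linearIndependent_of_injective (IsFractionRing.injective P (FractionRing P))
      ((generic_X r).linearIndependent (h₀.map _))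
  let : Algebra P R := (MvPolynomial.eval₂Hom (Int.castRingHom R) v).toAlgebra
  have hv : (fun i => algebraMap P R (MvPolynomial.X i)) = v :=
    funext fun i => MvPolynomial.eval₂Hom_X' _ _ i
  -- Specializing ω₀ gives admissible parameters for v, and uniqueness identifies them with ω.
  have hω : (fun a => algebraMap P R (ω₀ a)) = ω :=
    (hv ▸ h₀.map (algebraMap P R)).unique h
  have := LinearIndependent.algebraFamily_map (R := R) hP
  rwa [hv, hω] at this

end Universal

end DegBMW

theorem mainTheorem1 {R : Type*} [CommRing R] [Invertible (2 : R)] (ω : ℕ → R)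
    (r : ℕ) (hr : 1 ≤ r) (u : Fin r → R) :
    List.TFAE [
      LinearIndependent R (DegBMW.idealFamily ω u),
      LinearIndependent R (DegBMW.algebraFamily ω u),
      DegBMW.Admissible ω u,
      DegBMW.UAdmissible ω u] := by
  tfae_have 1 → 3 := DegBMW.admissible_of_idealFamily hr
  tfae_have 3 → 2 := DegBMW.linearIndependent_of_admissible
  tfae_have 2 → 1 := DegBMW.idealFamily_of_algebraFamily hr
  tfae_have 4 ↔ 3 := DegBMW.uAdmissible_iff_admissible hr ω u
  tfae_finish
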